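/- **Conventions.** All sequences $M=(M_k)_{k\ge 0}$ of weights consist of positive real numbers. - For $U\subseteq\mathbb R^n$ open, $C^M(U)$ is the set of $f\in C^\infty(U,\mathbb R)$ such that for every compact $K\subseteq U$ there are $C,\rho>0$ with $|\partial^\alpha f(x)|\le C\rho^{|\alpha|}\,|\alpha|!\,M_{|\alpha|}$ for all $\alpha\in\mathbb N^n$ and $x\in K$. The sequence $M$ is *quasianalytic* if for every $n$, every connected open $U\subseteq\mathbb R^n$ and every $a\in U$, the map sending $f\in C^M(U)$ to its Taylor series at $a$ is injective. - $M$ is *log-convex* if $M_k^2\le M_{k-1}M_{k+1}$ for all $k\ge1$, and *weakly log-convex* if $(k!\,M_k)_k$ is log-convex. A weakly log-convex $M$ has *moderate growth* if $\sup_{j,k\ge1}\bigl(M_{j+k}/(M_jM_k)\bigr)^{1/(j+k)}<\infty$. - $\mathcal F^M$ is the set of real sequences $(f_k)_{k\ge0}$ for which there are $C,\rho>0$ with $|f_k|\le C\rho^k\,k!\,M_k$ for all $k$. - $\check M_0:=1$ and $\check M_k:=M_k\prod_{j=1}^k\bigl(1-(j!\,M_j)^{-1/j}\bigr)^k$ for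 $k\ge1$. - $\mathcal L(M)$ (respectively $\mathcal L_w(M)$) is the set of all non-quasianalytic log-convex (respectively weakly log-convex) sequences $L$ with $L_k\ge M_k$ for all $k$. **Theorem 1.6.** Let $Q=(Q_k)_{k\ge0}$ be a quasianalytic sequence of positive real numbers. 1. If the sequence $\check Q$ is log-convex and positive, then $\mathcal F^Q=\bigcap_{L\in\mathcal L(Q)}\mathcal F^L$. 2. If $Q$ is weakly log-convex, then for all $L^1,L^2\in\mathcal L_w(Q)$ there exists $L\in\mathcal L_w(Q)$ with $L_k\le L^1_k$ and $L_k\le L^2_k$ for all $k$. 3. If $Q$ is weakly log-convex of moderate growth, then for each $L\in\mathcal L_w(Q)$ there exist $L'\in\mathcal L_w(Q)$ and $C>0$ such that $L'_{j+k}\le C^{j+k}L_jL_k$ for all $j,k\in\mathbb N$, where the case $j=k=0$ is claimed only if $Q_0\le L_0^2$ (which holds automatically when $Q_0\ge1$, in particular under the usual normalization $Q_0=1$). -/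

import Mathlib

open scoped ContDiff

namespace DenjoyCarleman

/-- The partial derivative `∂_{s 0} ∂_{s 1} ⋯ ∂_{s (k-1)} f (x)` of order `k` of a function on `ℝⁿ`.
For smooth `f`, as `s` runs through all maps `Fin k → Fin n`, this runs through all
`∂^α f (x)` with `|α| = k`. -/
noncomputable def partialDeriv {n k : ℕ} (s : Fin k → Fin n)
    (f : EuclideanSpace ℝ (Fin n) → ℝ) (x : EuclideanSpace ℝ (Fin n)) : ℝ :=
  iteratedFDeriv ℝ k f x (fun i => EuclideanSpace.single (s i) (1 : ℝ))

/-- `f ∈ C^M(U)`, the Denjoy--Carleman class: `f` is smooth on the open set `U`, and on each compact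
`K ⊆ U` one has `|∂^α f| ≤ C ρ^|α| |α|! M_|α|` for all multi-indices `α`.
Only the values of `f` on the open set `U` matter. -/
def MemClass (M : ℕ → ℝ) {n : ℕ} (U : Set (EuclideanSpace ℝ (Fin n)))
    (f : EuclideanSpace ℝ (Fin n) → ℝ) : Prop :=
  ContDiffOn ℝ ∞ f U ∧
    ∀ K : Set (EuclideanSpace ℝ (Fin n)), IsCompact K → K ⊆ U →
      ∃ C ρ : ℝ, 0 < C ∧ 0 < ρ ∧ ∀ (k : ℕ) (s : Fin k → Fin n), ∀ x ∈ K,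
        |partialDeriv s f x| ≤ C * ρ ^ k * (k.factorial : ℝ) * M k

/-- `C^M` is quasianalytic: for every `n`, every connected open `U ⊆ ℝⁿ` and every `a ∈ U`, the map
sending `f ∈ C^M(U)` to its Taylor series at `a` is injective. -/
def Quasianalytic (M : ℕ → ℝ) : Prop :=
  ∀ (n : ℕ) (U : Set (EuclideanSpace ℝ (Fin n))), IsOpen U → IsConnected U → ∀ a ∈ U,
    ∀ f g : EuclideanSpace ℝ (Fin n) → ℝ, MemClass M U f → MemClass M U g →
      (∀ (k : ℕ) (s : Fin k → Fin n), partialDeriv s f a = partialDeriv s g a) →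
      Set.EqOn f g U

/-- Log-convexity: `M_k² ≤ M_{k-1} M_{k+1}` for all `k ≥ 1`. -/
def LogConvex (M : ℕ → ℝ) : Prop :=
  ∀ k : ℕ, M (k + 1) ^ 2 ≤ M k * M (k + 2)

/-- Weak log-convexity: `k ↦ k! M_k` is log-convex. -/
def WeaklyLogConvex (M : ℕ → ℝ) : Prop :=
  LogConvex (fun k => (k.factorial : ℝ) * M k)

/-- Moderate growth: the supremum of `(M_{j+k} / (M_j M_k))^{1/(j+k)}` over `j, k ≥ 1` is finite. -/
def ModerateGrowth (M : ℕ → ℝ) : Prop :=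
  BddAbove {x : ℝ | ∃ j k : ℕ, 0 < j ∧ 0 < k ∧
    x = (M (j + k) / (M j * M k)) ^ (1 / ((j : ℝ) + (k : ℝ)))}

/-- The space `𝓕^M` of all real sequences `f` for which there are `ρ, C > 0` with
`|f_k| ≤ C ρ^k k! M_k` for all `k`. -/
def FSpace (M : ℕ → ℝ) : Set (ℕ → ℝ) :=
  {f | ∃ ρ : ℝ, 0 < ρ ∧ ∃ C : ℝ, 0 < C ∧ ∀ k : ℕ,
    |f k| ≤ C * ρ ^ k * (k.factorial : ℝ) * M k}

/-- The associated sequence `M̌`: `M̌_0 = 1` and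
`M̌_k = M_k ∏_{j=1}^k (1 - 1 / (j! M_j)^{1/j})^k` for `k ≥ 1`. -/
noncomputable def check (M : ℕ → ℝ) (k : ℕ) : ℝ :=
  if k = 0 then 1
  else M k * ∏ j ∈ Finset.Icc 1 k, (1 - 1 / ((j.factorial : ℝ) * M j) ^ (1 / (j : ℝ))) ^ k

/-- `𝓛(M)`: the non-quasianalytic log-convex sequences `L` of positive numbers with `L ≥ M`. -/
def LSet (M : ℕ → ℝ) : Set (ℕ → ℝ) :=
  {L | (∀ k, 0 < L k) ∧ (∀ k, M k ≤ L k) ∧ ¬ Quasianalytic L ∧ LogConvex L}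

/-- `𝓛_w(M)`: the non-quasianalytic weakly log-convex sequences `L` of positive numbers with
`L ≥ M`. -/
def LwSet (M : ℕ → ℝ) : Set (ℕ → ℝ) :=
  {L | (∀ k, 0 < L k) ∧ (∀ k, M k ≤ L k) ∧ ¬ Quasianalytic L ∧ WeaklyLogConvex L}

end DenjoyCarleman

/-!
Everything rests on the Denjoy–Carleman theorem for a weakly log-convex `M`: writing
`N k = k! * M k`, the class is non-quasianalytic if and only if `∑ N k / N (k + 1)` converges
(`not_quasianalytic_iff_summable`).

* If the sum diverges, a function flat at a point vanishes nearby, by Bang's argument. If `g` is not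
  zero, then at some point a derivative of order `j ≤ n` is at least `exp (j - n) * N j`. Moving by
  `N n / N (n + 1) / 3` keeps this property with `n + 1` in place of `n`, as integrating the
  derivatives downwards shows (`bang_growth`, `bang_persist`). The steps have infinite sum, so the
  flat point is reached: a contradiction. Several variables are reduced to lines.
* If the sum converges, averaging a ramp function successively over intervals of lengths
  proportional to `N k / N (k + 1)` gives in the limit a smooth function that is flat at `0` but not
  zero. Each derivative replaces one average by a difference quotient, which gives the bounds
  (`exists_flat_function`).

With this criterion the assertions concern sequences only. Given two convergent sums with ratios
`ν₁`, `ν₂`, the sequence with ratios `1 / (1 / ν₁ + 1 / ν₂)` lies below both, is log-convex and has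
a convergent sum; the maximum with `k! * Q k` is the required lower bound of `L₁` and `L₂`
(`exists_le_le_mem_LwSet`). For moderate growth, each ratio of `N` is used twice instead: the value
at `j + k` is then at most `N j * N k` (`exists_mem_LwSet_add_le`).

For the first assertion, let `d k` be the `k`-th root of `k! * check Q k` and
`S k = 1 + ∑_{1 ≤ j ≤ k} 1 / d j`. The product in the definition of `check Q` telescopes to give
`Q k = check Q k * S k ^ k` (`check_eq`). A sequence `f` outside `FSpace Q` is large, compared with
`k! * Q k`, along a sparse sequence `q j`. Put `lam j = S (q j) * exp j` and
`L k = C₁ * A ^ k * check Q k * W k`, where `W` is log-convex with the constant ratio `lam (j + 1)`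
between `q j` and `q (j + 1)`. At `q j` the factor `W` is at most `lam j ^ q j`, so `f` is not in
`FSpace L`. By the inequality of the means, `W k ^ (-1 / k)` is up to the factor `e` at most the
convex combination of `1 / lam j` and `1 / lam (j + 1)` with weights `q j / k` and `1 - q j / k`.
As `d k` grows at least linearly, this yields both `Q ≤ L` and the convergence of the sum for `L`
(`exists_mem_LSet_notMem`).
-/

namespace DenjoyCarleman

/-! ### Log-convex sequences -/

theorem LogConvex.ratio_monotone {N : ℕ → ℝ} (hN : ∀ k, 0 < N k) (h : LogConvex N) :
    Monotone fun k => N (k + 1) / N k :=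
  monotone_nat_of_le_succ fun k => by
    rw [div_le_div_iff₀ (hN _) (hN _)]
    nlinarith [h k]

theorem LogConvex.of_ratio_monotone {N : ℕ → ℝ} (hN : ∀ k, 0 < N k)
    (h : Monotone fun k => N (k + 1) / N k) : LogConvex N := fun k => by
  have h1 := h (Nat.le_succ k)
  simp only [Nat.succ_eq_add_one] at h1
  rw [div_le_div_iff₀ (hN _) (hN _)] at h1
  nlinarith [h1]

theorem prod_range_ratio {N : ℕ → ℝ} (hN : ∀ k, 0 < N k) (k : ℕ) :
    ∏ i ∈ Finset.range k, N (i + 1) / N i = N k / N 0 := by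
  induction k with
  | zero => simp [(hN 0).ne']
  | succ k ih =>
    rw [Finset.prod_range_succ, ih, mul_comm, div_mul_div_cancel₀ (hN k).ne']

theorem LogConvex.mul {M N : ℕ → ℝ} (hM : LogConvex M) (hN : LogConvex N) (hM0 : ∀ k, 0 < M k) :
    LogConvex fun k => M k * N k := fun k => by
  have := mul_le_mul (hM k) (hN k) (sq_nonneg _) (mul_pos (hM0 _) (hM0 _)).le
  calc (M (k + 1) * N (k + 1)) ^ 2 = M (k + 1) ^ 2 * N (k + 1) ^ 2 := by ring
    _ ≤ _ := this
    _ = _ := by ring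

theorem logConvex_geometric (C ρ : ℝ) : LogConvex fun k => C * ρ ^ k := fun k => by
  apply le_of_eq
  ring

theorem logConvex_factorial : LogConvex fun k => (k.factorial : ℝ) :=
  .of_ratio_monotone (fun k => by positivity) fun i j hij => by
    have (k : ℕ) : ((k + 1).factorial : ℝ) / k.factorial = k + 1 := by
      rw [Nat.factorial_succ]
      push_cast
      field_simp
    simp only [this]
    gcongr

theorem LogConvex.max {M N : ℕ → ℝ} (hM : LogConvex M) (hN : LogConvex N) (hM0 : ∀ k, 0 < M k)
    (hN0 : ∀ k, 0 < N k) : LogConvex fun k => max (M k) (N k) := fun k => by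
  have hle (a b : ℕ) : M a * M b ≤ Max.max (M a) (N a) * Max.max (M b) (N b) :=
    mul_le_mul (le_max_left _ _) (le_max_left _ _) (hM0 _).le ((hM0 _).le.trans (le_max_left _ _))
  have hle' (a b : ℕ) : N a * N b ≤ Max.max (M a) (N a) * Max.max (M b) (N b) :=
    mul_le_mul (le_max_right _ _) (le_max_right _ _) (hN0 _).le
      ((hN0 _).le.trans (le_max_right _ _))
  dsimp only
  rcases max_choice (M (k + 1)) (N (k + 1)) with h | h
  · rw [h]
    exact (hM k).trans (hle _ _)
  · rw [h]
    exact (hN k).trans (hle' _ _)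

/-! ### Bang's propagation argument on an interval -/

/-- A bound on the derivatives of order at most `n + 1` at `y` propagates to the right of `y`. The
weights `exp (j - (n + 1))` are chosen so that for `j = n + 1` the global bound
`|g (n + 1)| ≤ N (n + 1)` is already of the required form; lower orders follow by integrating. -/
theorem bang_growth {N : ℕ → ℝ} (hN : ∀ k, 0 < N k) (hlc : LogConvex N) {g : ℕ → ℝ → ℝ} {b : ℝ}
    (hg : ∀ j, ∀ t ∈ Set.Icc 0 b, HasDerivAt (g j) (g (j + 1) t) t)
    (hb : ∀ j, ∀ t ∈ Set.Icc 0 b, |g j t| ≤ N j) (n : ℕ) {y : ℝ} (hy : 0 ≤ y)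
    (hsmall : ∀ j ≤ n + 1, |g j y| ≤ Real.exp ((j : ℝ) - (n + 1)) * N j) {j : ℕ} (hj : j ≤ n + 1) :
    ∀ t ∈ Set.Icc y b, |g j t| ≤ Real.exp ((j : ℝ) - (n + 1)) * N j *
      Real.exp (Real.exp 1 * (N (n + 1) / N n) * (t - y)) := by
  set μ := Real.exp 1 * (N (n + 1) / N n) with hμ
  have hμ0 : 0 ≤ μ := mul_nonneg (Real.exp_pos _).le (div_pos (hN _) (hN _)).le
  induction hj using Nat.decreasingInduction with
  | self =>
    intro t ht
    have h1 : 1 ≤ Real.exp (μ * (t - y)) :=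
      Real.one_le_exp (mul_nonneg hμ0 (sub_nonneg.2 ht.1))
    have h2 := hb (n + 1) t ⟨hy.trans ht.1, ht.2⟩
    push_cast
    rw [sub_self, Real.exp_zero, one_mul]
    exact h2.trans (le_mul_of_one_le_right (hN _).le h1)
  | of_succ j hj ih =>
    intro t ht
    have hmem : ∀ s ∈ Set.Icc y b, s ∈ Set.Icc 0 b := fun s hs => ⟨hy.trans hs.1, hs.2⟩
    have key := image_norm_le_of_norm_deriv_right_le_deriv_boundary (f := g j) (f' := g (j + 1))
      (a := y) (b := b)
      (B := fun s => Real.exp ((j : ℝ) - (n + 1)) * N j * Real.exp (μ * (s - y)))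
      (B' := fun s => Real.exp ((j : ℝ) - (n + 1)) * N j * (Real.exp (μ * (s - y)) * μ))
      (fun s hs => (hg j s (hmem s hs)).continuousAt.continuousWithinAt)
      (fun s hs => (hg j s (hmem s ⟨hs.1, hs.2.le⟩)).hasDerivWithinAt)
      (by simpa using hsmall j hj.le)
      (fun s => by
        have h1 : HasDerivAt (fun s => μ * (s - y)) μ s := by
          simpa using ((hasDerivAt_id s).sub_const y).const_mul μ
        exact h1.exp.const_mul _)
      (fun s hs => by
        have h1 := ih s ⟨hs.1, hs.2.le⟩
        rw [Real.norm_eq_abs]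
        refine h1.trans ?_
        have h2 : N (j + 1) ≤ N j * (N (n + 1) / N n) := by
          have := hlc.ratio_monotone hN (Nat.lt_succ_iff.1 hj)
          dsimp only at this
          rw [div_le_iff₀ (hN j)] at this
          linarith
        have h3 : Real.exp (((j + 1 : ℕ) : ℝ) - (n + 1)) =
            Real.exp ((j : ℝ) - (n + 1)) * Real.exp 1 := by
          rw [← Real.exp_add]
          congr 1
          push_cast
          ring
        rw [h3]
        calc Real.exp ((j : ℝ) - (n + 1)) * Real.exp 1 * N (j + 1) * Real.exp (μ * (s - y))
            ≤ Real.exp ((j : ℝ) - (n + 1)) * Real.exp 1 * (N j * (N (n + 1) / N n)) *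
              Real.exp (μ * (s - y)) := by gcongr
          _ = _ := by rw [hμ]; ring)
    simpa using key ht

/-- Going left from `x` by steps of length `N k / N (k + 1) / 3`, the property that some derivative
of order `j ≤ n` has size at least `exp (j - n) * N j` persists, at the cost of raising `n` by one
in each step. -/
theorem bang_persist {N : ℕ → ℝ} (hN : ∀ k, 0 < N k) (hlc : LogConvex N) {g : ℕ → ℝ → ℝ} {b : ℝ}
    (hg : ∀ j, ∀ t ∈ Set.Icc 0 b, HasDerivAt (g j) (g (j + 1) t) t)
    (hb : ∀ j, ∀ t ∈ Set.Icc 0 b, |g j t| ≤ N j) {m : ℕ} (hm : Real.exp (-m) * N 0 ≤ |g 0 b|)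
    {n : ℕ} (hn : m ≤ n) : ∀ y ∈ Set.Icc 0 b, b - y ≤ ∑ k ∈ Finset.Ico m n, N k / N (k + 1) / 3 →
      ∃ j ≤ n, Real.exp ((j : ℝ) - n) * N j ≤ |g j y| := by
  induction n, hn using Nat.le_induction with
  | base =>
    intro y hy h
    simp only [Finset.Ico_self, Finset.sum_empty] at h
    obtain rfl : y = b := le_antisymm hy.2 (by linarith)
    exact ⟨0, Nat.zero_le _, by simpa using hm⟩
  | succ n hmn ih =>
    intro y hy h
    rw [Finset.sum_Ico_succ_top hmn] at h
    have hpos : 0 < N n / N (n + 1) / 3 := by have := hN n; have := hN (n + 1); positivity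
    set z := min b (y + N n / N (n + 1) / 3) with hz
    have hyz : y ≤ z := le_min hy.2 (by linarith)
    have hsum : 0 ≤ ∑ k ∈ Finset.Ico m n, N k / N (k + 1) / 3 :=
      Finset.sum_nonneg fun k _ => by have := hN k; have := hN (k + 1); positivity
    obtain ⟨j, hj, hjz⟩ := ih z ⟨hy.1.trans hyz, min_le_left _ _⟩ (by
      rcases min_choice b (y + N n / N (n + 1) / 3) with h' | h'
      · rw [hz, h']
        linarith
      · rw [hz, h']
        linarith)
    by_contra! hcon
    push_cast at hcon
    have h1 := bang_growth hN hlc hg hb n hy.1 (fun i hi => (hcon i hi).le)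
      (hj.trans n.le_succ) z ⟨hyz, min_le_left _ _⟩
    have h2 : Real.exp 1 * (N (n + 1) / N n) * (z - y) < 1 := by
      have h3 : z - y ≤ N n / N (n + 1) / 3 := by
        linarith [min_le_right b (y + N n / N (n + 1) / 3)]
      calc Real.exp 1 * (N (n + 1) / N n) * (z - y)
          ≤ Real.exp 1 * (N (n + 1) / N n) * (N n / N (n + 1) / 3) := by
            have := hN n
            have := hN (n + 1)
            gcongr
        _ = Real.exp 1 / 3 := by
            have := (hN n).ne'
            have := (hN (n + 1)).ne'
            field_simp
        _ < 1 := by linarith [Real.exp_one_lt_d9]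
    have h4 : Real.exp ((j : ℝ) - n) = Real.exp ((j : ℝ) - (n + 1)) * Real.exp 1 := by
      rw [← Real.exp_add]
      congr 1
      ring
    have h5 := hjz.trans h1
    rw [h4, mul_right_comm] at h5
    have h6 := le_of_mul_le_mul_left h5 (mul_pos (Real.exp_pos _) (hN j))
    exact absurd (Real.exp_le_exp.1 h6) (not_le.2 h2)

/-- The one-variable Denjoy–Carleman uniqueness theorem, for a function `g 0` with derivatives
`g j`, all vanishing at `0`. -/
theorem bang_unique {N : ℕ → ℝ} (hN : ∀ k, 0 < N k) (hlc : LogConvex N)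
    (hsum : ¬ Summable fun k => N k / N (k + 1)) {g : ℕ → ℝ → ℝ} {b : ℝ} (hb0 : 0 ≤ b)
    (hg : ∀ j, ∀ t ∈ Set.Icc 0 b, HasDerivAt (g j) (g (j + 1) t) t)
    (hb : ∀ j, ∀ t ∈ Set.Icc 0 b, |g j t| ≤ N j) (h0 : ∀ j, g j 0 = 0) : g 0 b = 0 := by
  by_contra hne
  have hpos : 0 < |g 0 b| := abs_pos.2 hne
  obtain ⟨m, hm⟩ : ∃ m : ℕ, Real.exp (-m) * N 0 ≤ |g 0 b| := by
    have h1 : Filter.Tendsto (fun m : ℕ => Real.exp (-(m : ℝ)) * N 0) Filter.atTop (nhds 0) := by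
      have := (Real.tendsto_exp_neg_atTop_nhds_zero.comp
        (tendsto_natCast_atTop_atTop (R := ℝ))).mul_const (N 0)
      simpa using this
    exact ((h1.eventually (gt_mem_nhds hpos)).exists).imp fun m hm => hm.le
  have h1 : Filter.Tendsto (fun n => ∑ i ∈ Finset.range n, N i / N (i + 1)) Filter.atTop
      Filter.atTop :=
    (not_summable_iff_tendsto_nat_atTop_of_nonneg fun n => (div_pos (hN _) (hN _)).le).1 hsum
  obtain ⟨n, hn, hmn⟩ := ((h1.eventually_ge_atTop
    (3 * b + ∑ i ∈ Finset.range m, N i / N (i + 1))).and (Filter.eventually_ge_atTop m)).exists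
  have h2 : b - 0 ≤ ∑ k ∈ Finset.Ico m n, N k / N (k + 1) / 3 := by
    rw [← Finset.sum_div, Finset.sum_Ico_eq_sub _ hmn]
    linarith
  obtain ⟨j, -, hj⟩ := bang_persist hN hlc hg hb hm hmn 0 ⟨le_rfl, hb0⟩ h2
  rw [h0, abs_zero] at hj
  exact absurd hj (not_le.2 (mul_pos (Real.exp_pos _) (hN j)))

/-! ### Reduction of several variables to one -/

/-- Directional derivatives are controlled by partial derivatives: expanding `v` in the standard
basis gives `n ^ k` terms. -/
theorem abs_iteratedFDeriv_diag_le {n k : ℕ} {f : EuclideanSpace ℝ (Fin n) → ℝ}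
    {x v : EuclideanSpace ℝ (Fin n)} {B : ℝ} (hB : ∀ s : Fin k → Fin n, |partialDeriv s f x| ≤ B) :
    |iteratedFDeriv ℝ k f x fun _ => v| ≤ (n * ‖v‖) ^ k * B := by
  have hv : v = ∑ i, v i • EuclideanSpace.single i (1 : ℝ) := by
    ext j
    simp [Pi.single_apply]
  have h1 : (iteratedFDeriv ℝ k f x fun _ => v) =
      ∑ s : Fin k → Fin n, (∏ i, v (s i)) * partialDeriv s f x := by
    conv_lhs => rw [hv]
    refine ((iteratedFDeriv ℝ k f x).toMultilinearMap.map_sum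
      fun _ i => v i • EuclideanSpace.single i (1 : ℝ)).trans ?_
    refine Finset.sum_congr rfl fun s _ => ?_
    exact (iteratedFDeriv ℝ k f x).map_smul_univ (fun i => v (s i)) _
  rw [h1]
  calc |∑ s : Fin k → Fin n, (∏ i, v (s i)) * partialDeriv s f x|
      ≤ ∑ s : Fin k → Fin n, |(∏ i, v (s i)) * partialDeriv s f x| :=
        Finset.abs_sum_le_sum_abs _ _
    _ ≤ ∑ _s : Fin k → Fin n, ‖v‖ ^ k * B := by
        refine Finset.sum_le_sum fun s _ => ?_
        rw [abs_mul, Finset.abs_prod]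
        have : ∏ i : Fin k, |v (s i)| ≤ ‖v‖ ^ k := by
          refine (Finset.prod_le_prod (fun _ _ => abs_nonneg _)
            fun i _ => PiLp.norm_apply_le v (s i)).trans ?_
          simp
        exact mul_le_mul this (hB s) (abs_nonneg _) (by positivity)
    _ = (n * ‖v‖) ^ k * B := by
        simp [mul_pow, mul_assoc]

theorem hasDerivAt_iteratedFDeriv_line {n : ℕ} {f : EuclideanSpace ℝ (Fin n) → ℝ}
    (x v : EuclideanSpace ℝ (Fin n)) (k : ℕ) {t : ℝ} (hf : ContDiffAt ℝ ∞ f (x + t • v)) :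
    HasDerivAt (fun t : ℝ => iteratedFDeriv ℝ k f (x + t • v) fun _ => v)
      (iteratedFDeriv ℝ (k + 1) f (x + t • v) fun _ => v) t := by
  have h1 : DifferentiableAt ℝ (iteratedFDeriv ℝ k f) (x + t • v) :=
    (hf.iteratedFDeriv_right (m := 1) (i := k) (by exact_mod_cast le_top)).differentiableAt
      one_ne_zero
  have h2 : HasDerivAt (fun t : ℝ => x + t • v) v t := by
    simpa using ((hasDerivAt_id t).smul_const v).const_add x
  have h3 := h1.hasFDerivAt.comp_hasDerivAt t h2
  have h4 := (ContinuousMultilinearMap.apply ℝ (fun _ : Fin k => EuclideanSpace ℝ (Fin n)) ℝ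
    fun _ => v).hasFDerivAt.comp_hasDerivAt t h3
  rw [iteratedFDeriv_succ_apply_left]
  exact h4

theorem MemClass.sub {M : ℕ → ℝ} (hM : ∀ k, 0 < M k) {n : ℕ} {U : Set (EuclideanSpace ℝ (Fin n))}
    (hU : IsOpen U) {f g : EuclideanSpace ℝ (Fin n) → ℝ} (hf : MemClass M U f)
    (hg : MemClass M U g) : MemClass M U (f - g) ∧
      ∀ (k : ℕ) (s : Fin k → Fin n), ∀ x ∈ U,
        partialDeriv s (f - g) x = partialDeriv s f x - partialDeriv s g x := by
  have hp (k : ℕ) (s : Fin k → Fin n) : ∀ x ∈ U,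
      partialDeriv s (f - g) x = partialDeriv s f x - partialDeriv s g x := fun x hx => by
    rw [partialDeriv, iteratedFDeriv_sub_apply
      ((hf.1.contDiffAt (hU.mem_nhds hx)).of_le (by exact_mod_cast le_top))
      ((hg.1.contDiffAt (hU.mem_nhds hx)).of_le (by exact_mod_cast le_top))]
    rfl
  refine ⟨⟨hf.1.sub hg.1, fun K hK hKU => ?_⟩, hp⟩
  obtain ⟨C₁, ρ₁, hC₁, hρ₁, h₁⟩ := hf.2 K hK hKU
  obtain ⟨C₂, ρ₂, hC₂, hρ₂, h₂⟩ := hg.2 K hK hKU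
  refine ⟨C₁ + C₂, max ρ₁ ρ₂, by positivity, by positivity, fun k s x hx => ?_⟩
  rw [hp k s x (hKU hx)]
  have := hM k
  calc |partialDeriv s f x - partialDeriv s g x|
      ≤ |partialDeriv s f x| + |partialDeriv s g x| := abs_sub _ _
    _ ≤ C₁ * ρ₁ ^ k * k.factorial * M k + C₂ * ρ₂ ^ k * k.factorial * M k :=
        add_le_add (h₁ k s x hx) (h₂ k s x hx)
    _ ≤ C₁ * max ρ₁ ρ₂ ^ k * k.factorial * M k + C₂ * max ρ₁ ρ₂ ^ k * k.factorial * M k := by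
        gcongr
        · exact le_max_left _ _
        · exact le_max_right _ _
    _ = _ := by ring

theorem MemClass.eventually_eq_zero {M : ℕ → ℝ} (hM : ∀ k, 0 < M k) (hlc : WeaklyLogConvex M)
    (hsum : ¬ Summable fun k : ℕ => (k.factorial * M k) / ((k + 1).factorial * M (k + 1)))
    {n : ℕ} {U : Set (EuclideanSpace ℝ (Fin n))} (hU : IsOpen U)
    {f : EuclideanSpace ℝ (Fin n) → ℝ} (hf : MemClass M U f) {x : EuclideanSpace ℝ (Fin n)}
    (hx : x ∈ U) (h0 : ∀ (k : ℕ) (s : Fin k → Fin n), partialDeriv s f x = 0) :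
    f =ᶠ[nhds x] 0 := by
  obtain ⟨r, hr, hrU⟩ := Metric.nhds_basis_closedBall.mem_iff.1 (hU.mem_nhds hx)
  obtain ⟨C, ρ, hC, hρ, hbd⟩ := hf.2 _ (isCompact_closedBall x r) hrU
  filter_upwards [Metric.closedBall_mem_nhds x hr] with y hy
  set v := y - x with hv
  have hvr : ‖v‖ ≤ r := by rwa [hv, ← dist_eq_norm]
  have hmem : ∀ t ∈ Set.Icc (0 : ℝ) 1, x + t • v ∈ Metric.closedBall x r := fun t ht => by
    rw [mem_closedBall_iff_norm, add_sub_cancel_left, norm_smul, Real.norm_of_nonneg ht.1]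
    exact (mul_le_of_le_one_left (norm_nonneg _) ht.2).trans hvr
  -- `n + 1` and `r + 1` absorb the dimension and the length of `v`, keeping the weights positive.
  set R : ℝ := (n + 1) * (r + 1) * ρ with hR
  have hR0 : 0 < R := by positivity
  set N : ℕ → ℝ := fun k => C * R ^ k * (k.factorial * M k) with hNdef
  have hfM (k : ℕ) : 0 < (k.factorial : ℝ) * M k := by have := hM k; positivity
  have hN (k : ℕ) : 0 < N k := by have := hfM k; positivity
  have hNlc : LogConvex N :=
    (logConvex_geometric C R).mul hlc fun k => by positivity
  have hNsum : ¬ Summable fun k => N k / N (k + 1) := fun h => hsum <| by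
    refine (h.mul_left R).congr fun k => ?_
    simp only [hNdef]
    have := (hfM (k + 1)).ne'
    rw [pow_succ]
    field_simp
  have key := bang_unique hN hNlc hNsum zero_le_one
    (g := fun k t => iteratedFDeriv ℝ k f (x + t • v) fun _ => v)
    (fun j t ht => hasDerivAt_iteratedFDeriv_line x v j
      (hf.1.contDiffAt (hU.mem_nhds (hrU (hmem t ht)))))
    (fun j t ht => by
      refine (abs_iteratedFDeriv_diag_le fun s => hbd j s _ (hmem t ht)).trans ?_
      have hle : (n : ℝ) * ‖v‖ ≤ (n + 1) * (r + 1) :=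
        mul_le_mul (by linarith) (by linarith) (norm_nonneg _) (by positivity)
      have := hM j
      calc ((n : ℝ) * ‖v‖) ^ j * (C * ρ ^ j * j.factorial * M j)
          ≤ ((n + 1) * (r + 1)) ^ j * (C * ρ ^ j * j.factorial * M j) := by gcongr
        _ = N j := by simp only [hNdef, hR, mul_pow]; ring)
    (fun j => by
      have h := abs_iteratedFDeriv_diag_le (v := v) (B := 0) (f := f) (x := x) (k := j)
        fun s => by rw [h0 j s, abs_zero]
      simpa using h)
  simpa [hv] using key

/-- The Denjoy–Carleman theorem, divergent case. -/
theorem quasianalytic_of_not_summable {M : ℕ → ℝ} (hM : ∀ k, 0 < M k) (hlc : WeaklyLogConvex M)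
    (hsum : ¬ Summable fun k : ℕ => (k.factorial * M k) / ((k + 1).factorial * M (k + 1))) :
    Quasianalytic M := by
  intro n U hU hUc a ha f g hf hg hfg
  obtain ⟨hh, hp⟩ := hf.sub hM hU hg
  have hloc {x : EuclideanSpace ℝ (Fin n)} (hx : x ∈ U)
      (h0 : ∀ (k : ℕ) (s : Fin k → Fin n), partialDeriv s (f - g) x = 0) :=
    hh.eventually_eq_zero hM hlc hsum hU hx h0
  have hsub : U ⊆ {x | ∀ᶠ y in nhds x, (f - g) y = 0} := by
    refine hUc.isPreconnected.subset_of_closure_inter_subset isOpen_setOfPred_eventually_nhds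
      ⟨a, ha, hloc ha fun k s => by rw [hp k s a ha, hfg, sub_self]⟩ ?_
    rintro x ⟨hxc, hxU⟩
    refine hloc hxU fun k s => ?_
    have hcont : ContinuousAt (partialDeriv s (f - g)) x := by
      have h1 : ContinuousAt (iteratedFDeriv ℝ k (f - g)) x :=
        ((hh.1.contDiffAt (hU.mem_nhds hxU)).iteratedFDeriv_right (m := 0) (i := k)
          (by exact_mod_cast le_top)).continuousAt
      exact (ContinuousMultilinearMap.apply ℝ (fun _ : Fin k => EuclideanSpace ℝ (Fin n)) ℝ
        fun i => EuclideanSpace.single (s i) (1 : ℝ)).continuous.continuousAt.comp h1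
    by_contra hne
    obtain ⟨y, hy, hyu⟩ := mem_closure_iff_nhds.1 hxc _ (hcont.eventually_ne hne)
    refine hy ?_
    have h2 : f - g =ᶠ[nhds y] fun _ => 0 := hyu
    rw [partialDeriv, (h2.iteratedFDeriv ℝ k).eq_of_nhds]
    simp
  intro x hx
  exact sub_eq_zero.1 (hsub hx).self_of_nhds

/-! ### Flat functions from iterated averages -/

/-- The one-sided average of `g` over `[x - a, x]`. -/
noncomputable def leftAverage (a : ℝ) (g : ℝ → ℝ) (x : ℝ) : ℝ := (∫ t in (x - a)..x, g t) / a

/-- The backward difference quotient of `g` with step `a`, which is the derivative of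
`leftAverage a g`. -/
noncomputable def leftQuotient (a : ℝ) (g : ℝ → ℝ) (x : ℝ) : ℝ := (g x - g (x - a)) / a

/-- The composition of `m` averages, with steps `a k`, `a (k + 1)`, …, `a (k + m - 1)`, applied to
the ramp `x ↦ min (max x 0) 1`. -/
noncomputable def iteratedAverage (a : ℕ → ℝ) : ℕ → ℕ → ℝ → ℝ
  | 0, _ => fun x => min (max x 0) 1
  | m + 1, k => leftAverage (a k) (iteratedAverage a m (k + 1))

theorem leftAverage_eq_integral_sub {a : ℝ} (g : ℝ → ℝ) (x : ℝ) :
    leftAverage a g x = (∫ t in (0 : ℝ)..a, g (x - t)) / a := by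
  rw [leftAverage, intervalIntegral.integral_comp_sub_left (fun t => g t), sub_zero]

theorem hasDerivAt_leftAverage {a : ℝ} {g : ℝ → ℝ} (hg : Continuous g) (x : ℝ) :
    HasDerivAt (leftAverage a g) (leftQuotient a g x) x := by
  have h1 (y : ℝ) : HasDerivAt (fun u => ∫ t in (0 : ℝ)..u, g t) (g y) y :=
    intervalIntegral.integral_hasDerivAt_right (hg.intervalIntegrable _ _)
      (hg.stronglyMeasurableAtFilter _ _) hg.continuousAt
  have h2 : HasDerivAt (fun u => ∫ t in (0 : ℝ)..(u - a), g t) (g (x - a)) x :=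
    (h1 (x - a)).comp_sub_const x a
  refine (((h1 x).sub h2).div_const a).congr_of_eventuallyEq (.of_forall fun u => ?_)
  simp only [leftAverage, Pi.sub_apply]
  rw [intervalIntegral.integral_interval_sub_left (hg.intervalIntegrable _ _)
    (hg.intervalIntegrable _ _)]

theorem abs_leftAverage_sub_le {a : ℝ} (ha : 0 < a) {g h : ℝ → ℝ} (hg : Continuous g)
    (hh : Continuous h) {x y C : ℝ} (hC : ∀ t ∈ Set.Icc 0 a, |g (x - t) - h (y - t)| ≤ C) :
    |leftAverage a g x - leftAverage a h y| ≤ C := by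
  rw [leftAverage_eq_integral_sub, leftAverage_eq_integral_sub, ← sub_div, abs_div, abs_of_pos ha,
    div_le_iff₀ ha, ← intervalIntegral.integral_sub]
  · have := intervalIntegral.norm_integral_le_of_norm_le_const (a := 0) (b := a) (C := C)
      (f := fun t => g (x - t) - h (y - t)) fun t ht => by
        rw [Set.uIoc_of_le ha.le] at ht
        exact hC t ⟨ht.1.le, ht.2⟩
    simpa [abs_of_pos ha] using this
  · exact (hg.comp (continuous_const.sub continuous_id)).intervalIntegrable _ _
  · exact (hh.comp (continuous_const.sub continuous_id)).intervalIntegrable _ _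

theorem leftAverage_const {a : ℝ} (ha : 0 < a) (c x : ℝ) : leftAverage a (fun _ => c) x = c := by
  rw [leftAverage]
  simp
  field_simp

section IteratedAverage

variable {a : ℕ → ℝ} (ha : ∀ k, 0 < a k)
include ha

theorem lipschitz_iteratedAverage (m k : ℕ) : LipschitzWith 1 (iteratedAverage a m k) := by
  induction m generalizing k with
  | zero => exact (LipschitzWith.id.max_const 0).min_const 1
  | succ m ih =>
    refine LipschitzWith.of_dist_le_mul fun x y => ?_
    have hc := (ih (k + 1)).continuous
    rw [NNReal.coe_one, one_mul, Real.dist_eq, Real.dist_eq]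
    refine abs_leftAverage_sub_le (ha k) hc hc fun t _ => ?_
    have := (ih (k + 1)).dist_le_mul (x - t) (y - t)
    simpa [Real.dist_eq] using this

theorem abs_iteratedAverage_le (m k : ℕ) (x : ℝ) : |iteratedAverage a m k x| ≤ 1 := by
  induction m generalizing k x with
  | zero =>
    rw [iteratedAverage, abs_of_nonneg (le_min (le_max_right _ _) zero_le_one)]
    exact min_le_right _ _
  | succ m ih =>
    have := abs_leftAverage_sub_le (ha k) (lipschitz_iteratedAverage ha m (k + 1)).continuous
      (continuous_const (y := (0 : ℝ))) (x := x) (y := x) (C := 1)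
      fun t _ => by simpa using ih (k + 1) (x - t)
    rwa [leftAverage_const (ha k), sub_zero] at this

theorem iteratedAverage_of_nonpos (m k : ℕ) {x : ℝ} (hx : x ≤ 0) :
    iteratedAverage a m k x = 0 := by
  induction m generalizing k x with
  | zero => simp [iteratedAverage, hx]
  | succ m ih =>
    have := abs_leftAverage_sub_le (ha k) (lipschitz_iteratedAverage ha m (k + 1)).continuous
      (continuous_const (y := (0 : ℝ))) (x := x) (y := x) (C := 0)
      fun t ht => by rw [ih (k + 1) (by linarith [ht.1])]; simp
    rw [leftAverage_const (ha k), sub_zero] at this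
    exact abs_nonpos_iff.1 this

theorem dist_iteratedAverage_succ_le (m k : ℕ) (x : ℝ) :
    dist (iteratedAverage a m k x) (iteratedAverage a (m + 1) k x) ≤ a (k + m) := by
  induction m generalizing k x with
  | zero =>
    have hl := lipschitz_iteratedAverage ha 0 (k + 1)
    have := abs_leftAverage_sub_le (ha k) hl.continuous
      (continuous_const (y := iteratedAverage a 0 k x)) (x := x) (y := x) (C := a k)
      fun t ht => by
        have := hl.dist_le_mul (x - t) x
        rw [Real.dist_eq] at this
        refine this.trans ?_
        rw [Real.dist_eq]
        simpa [abs_of_nonneg ht.1] using ht.2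
    rwa [leftAverage_const (ha k), ← Real.dist_eq, dist_comm] at this
  | succ m ih =>
    rw [Real.dist_eq]
    refine abs_leftAverage_sub_le (ha k) (lipschitz_iteratedAverage ha m (k + 1)).continuous
      (lipschitz_iteratedAverage ha (m + 1) (k + 1)).continuous fun t _ => ?_
    have := ih (k + 1) (x - t)
    rwa [Real.dist_eq, add_right_comm, add_assoc] at this

/-- Infinitely many averages with summable steps: functions `F k` such that `F k` is the average of
`F (k + 1)` with step `a k`. They vanish on the left half-line but not identically, because the
averages move the ramp by at most `∑ a k ≤ 1 / 2`. -/
theorem exists_average_chain (hs : Summable a) (hs' : ∑' k, a k ≤ 1 / 2) :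
    ∃ F : ℕ → ℝ → ℝ, (∀ k, Continuous (F k)) ∧ (∀ k x, |F k x| ≤ 1) ∧
      (∀ k, ∀ x ≤ 0, F k x = 0) ∧ F 0 1 ≠ 0 ∧ ∀ k, F k = leftAverage (a k) (F (k + 1)) := by
  have hcau (k : ℕ) (x : ℝ) : CauchySeq fun m => iteratedAverage a m k x :=
    cauchySeq_of_dist_le_of_summable (fun m => a (k + m))
      (fun m => dist_iteratedAverage_succ_le ha m k x)
      (by simpa [add_comm] using (summable_nat_add_iff k).2 hs)
  choose F hF using fun k x => cauchySeq_tendsto_of_complete (hcau k x)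
  have hlip (k : ℕ) : LipschitzWith 1 (F k) := LipschitzWith.of_dist_le_mul fun x y =>
    le_of_tendsto ((hF k x).dist (hF k y))
      (.of_forall fun m => (lipschitz_iteratedAverage ha m k).dist_le_mul x y)
  have hcont (k : ℕ) := (hlip k).continuous
  refine ⟨F, hcont, fun k x => ?_, fun k x hx => ?_, fun h0 => ?_, fun k => ?_⟩
  · exact le_of_tendsto (hF k x).abs (.of_forall fun m => abs_iteratedAverage_le ha m k x)
  · exact tendsto_nhds_unique (hF k x)
      (by simp [iteratedAverage_of_nonpos ha _ k hx])
  · have := dist_le_tsum_of_dist_le_of_tendsto (fun m => a (0 + m))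
      (fun m => dist_iteratedAverage_succ_le ha m 0 1) (by simpa using hs) (hF 0 1) 0
    rw [h0] at this
    simp [iteratedAverage] at this
    linarith
  · ext x
    refine tendsto_nhds_unique ((Filter.tendsto_add_atTop_iff_nat 1).2 (hF k x)) ?_
    have := intervalIntegral.tendsto_integral_filter_of_dominated_convergence
      (μ := MeasureTheory.volume) (a := x - a k) (b := x)
      (F := fun m => iteratedAverage a m (k + 1)) (f := F (k + 1)) (l := Filter.atTop)
      (fun _ => 1)
      (.of_forall fun m =>
        (lipschitz_iteratedAverage ha m (k + 1)).continuous.aestronglyMeasurable)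
      (.of_forall fun m => .of_forall fun t _ => abs_iteratedAverage_le ha m (k + 1) t)
      intervalIntegrable_const (.of_forall fun t _ => hF (k + 1) t)
    exact this.div_const (a k)

end IteratedAverage

theorem leftQuotient_hasDerivAt {a : ℝ} {g g' : ℝ → ℝ} (h : ∀ x, HasDerivAt g (g' x) x) (x : ℝ) :
    HasDerivAt (leftQuotient a g) (leftQuotient a g' x) x := by
  have h2 : HasDerivAt (fun u => g (u - a)) (g' (x - a)) x :=
    (h (x - a)).comp_sub_const x a
  exact ((h x).sub h2).div_const a

/-- The composition of the difference quotients with steps `a 0`, …, `a (k - 1)`. -/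
noncomputable def iteratedQuotient (a : ℕ → ℝ) : ℕ → (ℝ → ℝ) → ℝ → ℝ
  | 0, g => g
  | k + 1, g => iteratedQuotient a k (leftQuotient (a k) g)

theorem iteratedQuotient_hasDerivAt (a : ℕ → ℝ) (k : ℕ) {g g' : ℝ → ℝ}
    (h : ∀ x, HasDerivAt g (g' x) x) (x : ℝ) :
    HasDerivAt (iteratedQuotient a k g) (iteratedQuotient a k g' x) x := by
  induction k generalizing g g' with
  | zero => exact h x
  | succ k ih => exact ih (leftQuotient_hasDerivAt h)

theorem abs_iteratedQuotient_le {a : ℕ → ℝ} (ha : ∀ k, 0 < a k) (k : ℕ) {g : ℝ → ℝ} {C : ℝ}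
    (h : ∀ x, |g x| ≤ C) (x : ℝ) :
    |iteratedQuotient a k g x| ≤ (∏ i ∈ Finset.range k, 2 / a i) * C := by
  induction k generalizing g C with
  | zero => simpa [iteratedQuotient] using h x
  | succ k ih =>
    refine (ih (g := leftQuotient (a k) g) (C := 2 / a k * C) fun y => ?_).trans_eq ?_
    · rw [leftQuotient, abs_div, abs_of_pos (ha k), div_mul_eq_mul_div]
      have := abs_sub (g y) (g (y - a k))
      have := ha k
      gcongr
      linarith [h y, h (y - a k)]
    · rw [Finset.prod_range_succ, mul_assoc]

theorem iteratedQuotient_of_nonpos {a : ℕ → ℝ} (ha : ∀ k, 0 < a k) (k : ℕ) {g : ℝ → ℝ}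
    (h : ∀ x ≤ 0, g x = 0) {x : ℝ} (hx : x ≤ 0) : iteratedQuotient a k g x = 0 := by
  induction k generalizing g with
  | zero => exact h x hx
  | succ k ih =>
    refine ih fun y hy => ?_
    rw [leftQuotient, h y hy, h (y - a k) (by linarith [ha k])]
    simp

theorem exists_flat_function {a : ℕ → ℝ} (ha : ∀ k, 0 < a k) (hs : Summable a)
    (hs' : ∑' k, a k ≤ 1 / 2) :
    ∃ f : ℝ → ℝ, ContDiff ℝ ∞ f ∧ (∀ k, iteratedDeriv k f 0 = 0) ∧ f 1 ≠ 0 ∧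
      ∀ k x, |iteratedDeriv k f x| ≤ ∏ i ∈ Finset.range k, 2 / a i := by
  obtain ⟨F, hc, hb, h0, h1, hF⟩ := exists_average_chain ha hs hs'
  have hd (k : ℕ) (x : ℝ) : HasDerivAt (iteratedQuotient a k (F k))
      (iteratedQuotient a (k + 1) (F (k + 1)) x) x := by
    refine iteratedQuotient_hasDerivAt a k (fun y => ?_) x
    conv => enter [1]; rw [hF k]
    exact hasDerivAt_leftAverage (hc (k + 1)) y
  have hit (k : ℕ) : iteratedDeriv k (F 0) = iteratedQuotient a k (F k) := by
    induction k with
    | zero => simp [iteratedQuotient]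
    | succ k ih =>
      rw [iteratedDeriv_succ, ih]
      exact funext fun x => (hd k x).deriv
  refine ⟨F 0, ?_, fun k => ?_, h1, fun k x => ?_⟩
  · refine contDiff_of_differentiable_iteratedDeriv fun k _ => ?_
    rw [hit]
    exact fun x => (hd k x).differentiableAt
  · rw [hit]
    exact iteratedQuotient_of_nonpos ha k (h0 k) le_rfl
  · rw [hit]
    simpa using abs_iteratedQuotient_le ha k (hb k) x

/-- The Denjoy–Carleman theorem, convergent case. -/
theorem not_quasianalytic_of_summable {M : ℕ → ℝ} (hM : ∀ k, 0 < M k)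
    (hsum : Summable fun k : ℕ => (k.factorial * M k) / ((k + 1).factorial * M (k + 1))) :
    ¬ Quasianalytic M := by
  set N : ℕ → ℝ := fun k => k.factorial * M k with hN
  have hN0 (k : ℕ) : 0 < N k := by have := hM k; positivity
  set T : ℝ := ∑' k, N k / N (k + 1) with hT
  have hT0 : 0 ≤ T := tsum_nonneg fun k => (div_pos (hN0 _) (hN0 _)).le
  -- The factor makes the sum of the steps at most `1 / 2`.
  set c : ℝ := 1 / (2 * (T + 1)) with hcdef
  have hc : 0 < c := by positivity
  have ha (k : ℕ) : 0 < c * (N k / N (k + 1)) := mul_pos hc (div_pos (hN0 _) (hN0 _))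
  obtain ⟨f, hf, hf0, hf1, hfb⟩ := exists_flat_function ha (hsum.mul_left c) (by
    rw [tsum_mul_left, ← hT, hcdef, div_mul_eq_mul_div, div_le_div_iff₀ (by positivity) (by simp)]
    linarith)
  set π := (EuclideanSpace.proj 0 : EuclideanSpace ℝ (Fin 1) →L[ℝ] ℝ) with hπ
  have hpd {k : ℕ} (s : Fin k → Fin 1) (x : EuclideanSpace ℝ (Fin 1)) :
      partialDeriv s (f ∘ π) x = iteratedDeriv k f (x 0) := by
    rw [partialDeriv, π.iteratedFDeriv_comp_right hf x (by exact_mod_cast le_top),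
      iteratedDeriv_eq_iteratedFDeriv, ContinuousMultilinearMap.compContinuousLinearMap_apply]
    congr 1
    ext i
    simp [hπ, Subsingleton.elim (s i) 0]
  have hzero {k : ℕ} (s : Fin k → Fin 1) (x : EuclideanSpace ℝ (Fin 1)) :
      partialDeriv s (0 : EuclideanSpace ℝ (Fin 1) → ℝ) x = 0 := by
    simp [partialDeriv, Pi.zero_def]
  intro hq
  have key := hq 1 Set.univ isOpen_univ isConnected_univ 0 (Set.mem_univ _) (f ∘ π) 0
    ⟨(hf.comp π.contDiff).contDiffOn, fun K _ _ => ⟨1 / N 0, 2 / c, one_div_pos.2 (hN0 0),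
      by positivity, fun k s x _ => ?_⟩⟩
    ⟨contDiff_const.contDiffOn, fun K _ _ => ⟨1, 1, one_pos, one_pos, fun k s x _ => by
      rw [hzero, abs_zero]
      have := hM k
      positivity⟩⟩
    (fun k s => by rw [hpd, hzero]; exact hf0 k)
  · apply hf1
    have := key (Set.mem_univ (EuclideanSpace.single 0 1))
    simpa [hπ] using this
  · rw [hpd]
    refine (hfb k _).trans_eq ?_
    have h1 (i : ℕ) : 2 / (c * (N i / N (i + 1))) = 2 / c * (N (i + 1) / N i) := by
      have := (hN0 i).ne'
      have := (hN0 (i + 1)).ne'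
      field_simp
    simp only [h1]
    rw [Finset.prod_mul_distrib, Finset.prod_const, Finset.card_range, prod_range_ratio hN0]
    simp only [hN]
    ring

theorem not_quasianalytic_iff_summable {M : ℕ → ℝ} (hM : ∀ k, 0 < M k) (hlc : WeaklyLogConvex M) :
    ¬ Quasianalytic M ↔
      Summable fun k : ℕ => (k.factorial * M k) / ((k + 1).factorial * M (k + 1)) :=
  ⟨fun h => by_contra fun hs => h (quasianalytic_of_not_summable hM hlc hs),
    not_quasianalytic_of_summable hM⟩

/-! ### Weakly log-convex non-quasianalytic majorants -/

/-- Taking the maximum with `k! * Q k` turns a log-convex `P` with summable reciprocal ratios into a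
non-quasianalytic weakly log-convex majorant of `Q`. -/
theorem mem_LwSet_max {Q P : ℕ → ℝ} (hQ0 : ∀ k, 0 < Q k) (hQ : WeaklyLogConvex Q)
    (hP0 : ∀ k, 0 < P k) (hP : LogConvex P) (hs : Summable fun k => P k / P (k + 1)) :
    (fun k => max (P k) (k.factorial * Q k) / k.factorial) ∈ LwSet Q := by
  set L : ℕ → ℝ := fun k => max (P k) (k.factorial * Q k) / k.factorial with hL
  have hq0 (k : ℕ) : 0 < (k.factorial : ℝ) * Q k := by have := hQ0 k; positivity
  have hfac (k : ℕ) : (k.factorial : ℝ) * L k = max (P k) (k.factorial * Q k) := by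
    simp only [hL]
    field_simp
  have hL0 (k : ℕ) : 0 < L k := div_pos (lt_max_of_lt_left (hP0 k)) (by positivity)
  refine ⟨hL0, fun k => ?_, fun hqa => ?_, ?_⟩
  · simp only [hL]
    rw [le_div_iff₀ (by positivity), mul_comm]
    exact le_max_right _ _
  · -- The class of `P` is contained in the class of `L`.
    refine not_quasianalytic_of_summable (M := fun k => P k / k.factorial)
      (fun k => div_pos (hP0 k) (by positivity)) (hs.congr fun k => ?_) ?_
    · rw [mul_div_cancel₀ _ (by positivity), mul_div_cancel₀ _ (by positivity)]
    · intro n U hU hUc a ha f g hf hg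
      have hmono {f : EuclideanSpace ℝ (Fin n) → ℝ}
          (hf : MemClass (fun k => P k / k.factorial) U f) : MemClass L U f := by
        refine ⟨hf.1, fun K hK hKU => ?_⟩
        obtain ⟨C, ρ, hC, hρ, h⟩ := hf.2 K hK hKU
        refine ⟨C, ρ, hC, hρ, fun k s x hx => (h k s x hx).trans ?_⟩
        simp only [hL]
        gcongr
        exact le_max_left _ _
      exact hqa n U hU hUc a ha f g (hmono hf) (hmono hg)
  · have : (fun k : ℕ => (k.factorial : ℝ) * L k) = fun k => max (P k) (k.factorial * Q k) :=
      funext hfac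
    rw [WeaklyLogConvex, this]
    exact hP.max hQ hP0 hq0

/-- The log-convex sequence with value `c` at `0` whose ratios are the parallel sums of the ratios
of `M` and `N`. -/
noncomputable def parallelSum (M N : ℕ → ℝ) (c : ℝ) (k : ℕ) : ℝ :=
  c * ∏ i ∈ Finset.range k, (M i / M (i + 1) + N i / N (i + 1))⁻¹

section ParallelSum

variable {M N : ℕ → ℝ} (hM : ∀ k, 0 < M k) (hN : ∀ k, 0 < N k) {c : ℝ} (hc : 0 < c)
include hM hN hc

theorem parallelSum_pos (k : ℕ) : 0 < parallelSum M N c k :=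
  mul_pos hc <| Finset.prod_pos fun _ _ =>
    inv_pos.2 (add_pos (div_pos (hM _) (hM _)) (div_pos (hN _) (hN _)))

theorem parallelSum_ratio (k : ℕ) : parallelSum M N c (k + 1) / parallelSum M N c k =
    (M k / M (k + 1) + N k / N (k + 1))⁻¹ := by
  have h := (parallelSum_pos hM hN hc k).ne'
  rw [div_eq_iff h, parallelSum, Finset.prod_range_succ, parallelSum]
  ring

theorem parallelSum_logConvex (hlM : LogConvex M) (hlN : LogConvex N) :
    LogConvex (parallelSum M N c) :=
  .of_ratio_monotone (parallelSum_pos hM hN hc) fun i j hij => by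
    have h1 := hlM.ratio_monotone hM hij
    have h2 := hlN.ratio_monotone hN hij
    dsimp only at h1 h2 ⊢
    rw [parallelSum_ratio hM hN hc, parallelSum_ratio hM hN hc]
    rw [← inv_div (M j), ← inv_div (M i),
      inv_le_inv₀ (div_pos (hM _) (hM _)) (div_pos (hM _) (hM _))] at h1
    rw [← inv_div (N j), ← inv_div (N i),
      inv_le_inv₀ (div_pos (hN _) (hN _)) (div_pos (hN _) (hN _))] at h2
    exact inv_anti₀ (add_pos (div_pos (hM _) (hM _)) (div_pos (hN _) (hN _))) (add_le_add h1 h2)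

end ParallelSum

theorem parallelSum_le {M N : ℕ → ℝ} (hM : ∀ k, 0 < M k) (hN : ∀ k, 0 < N k) {c : ℝ}
    (h : c ≤ M 0) (k : ℕ) : parallelSum M N c k ≤ M k := by
  have h1 : ∏ i ∈ Finset.range k, (M i / M (i + 1) + N i / N (i + 1))⁻¹ ≤ M k / M 0 := by
    rw [← prod_range_ratio hM]
    refine Finset.prod_le_prod (fun i _ => (inv_pos.2
      (add_pos (div_pos (hM _) (hM _)) (div_pos (hN _) (hN _)))).le) fun i _ => ?_
    rw [← inv_div (M i)]
    exact inv_anti₀ (div_pos (hM _) (hM _)) (le_add_of_nonneg_right (div_pos (hN _) (hN _)).le)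
  calc parallelSum M N c k ≤ M 0 * (M k / M 0) :=
        mul_le_mul h h1 (Finset.prod_nonneg fun i _ => (inv_pos.2
          (add_pos (div_pos (hM _) (hM _)) (div_pos (hN _) (hN _)))).le) (hM 0).le
    _ = M k := mul_div_cancel₀ _ (hM 0).ne'

theorem parallelSum_comm (M N : ℕ → ℝ) (c : ℝ) : parallelSum M N c = parallelSum N M c := by
  ext k
  simp only [parallelSum, add_comm]

/-- `LwSet Q` is directed downwards. -/
theorem exists_le_le_mem_LwSet {Q : ℕ → ℝ} (hQ0 : ∀ k, 0 < Q k) (hQ : WeaklyLogConvex Q)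
    {L₁ L₂ : ℕ → ℝ} (h₁ : L₁ ∈ LwSet Q) (h₂ : L₂ ∈ LwSet Q) :
    ∃ L ∈ LwSet Q, (∀ k, L k ≤ L₁ k) ∧ ∀ k, L k ≤ L₂ k := by
  obtain ⟨hp₁, hQ₁, hn₁, hl₁⟩ := h₁
  obtain ⟨hp₂, hQ₂, hn₂, hl₂⟩ := h₂
  set N₁ : ℕ → ℝ := fun k => k.factorial * L₁ k with hN₁
  set N₂ : ℕ → ℝ := fun k => k.factorial * L₂ k with hN₂
  have hs₁ : Summable fun k => N₁ k / N₁ (k + 1) := (not_quasianalytic_iff_summable hp₁ hl₁).1 hn₁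
  have hs₂ : Summable fun k => N₂ k / N₂ (k + 1) := (not_quasianalytic_iff_summable hp₂ hl₂).1 hn₂
  have h0₁ (k : ℕ) : 0 < N₁ k := by have := hp₁ k; positivity
  have h0₂ (k : ℕ) : 0 < N₂ k := by have := hp₂ k; positivity
  have hc : 0 < min (N₁ 0) (N₂ 0) := lt_min (h0₁ 0) (h0₂ 0)
  set P := parallelSum N₁ N₂ (min (N₁ 0) (N₂ 0)) with hP
  have hPs : Summable fun k => P k / P (k + 1) := (hs₁.add hs₂).congr fun k => by
    rw [← inv_div (P (k + 1)), hP, parallelSum_ratio h0₁ h0₂ hc, inv_inv]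
  refine ⟨_, mem_LwSet_max hQ0 hQ (parallelSum_pos h0₁ h0₂ hc)
    (parallelSum_logConvex h0₁ h0₂ hc hl₁ hl₂) hPs, fun k => ?_, fun k => ?_⟩
  · rw [div_le_iff₀ (by positivity), mul_comm (L₁ k)]
    exact max_le (parallelSum_le h0₁ h0₂ (min_le_left _ _) k)
      (mul_le_mul_of_nonneg_left (hQ₁ k) (by positivity))
  · rw [div_le_iff₀ (by positivity), mul_comm (L₂ k)]
    refine max_le ?_ (mul_le_mul_of_nonneg_left (hQ₂ k) (by positivity))
    rw [parallelSum_comm]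
    exact parallelSum_le h0₂ h0₁ (min_le_right _ _) k

/-! ### Moderate growth -/

theorem LogConvex.mul_le_mul_of_add {N : ℕ → ℝ} (hN : ∀ k, 0 < N k) (h : LogConvex N) {i d : ℕ}
    (e : ℕ) : N (i + d) * N (i + e) ≤ N i * N (i + d + e) := by
  induction e with
  | zero => simp [mul_comm]
  | succ e ih =>
    have h1 := h.ratio_monotone hN (show i + e ≤ i + d + e by lia)
    dsimp only at h1
    have h2 := mul_le_mul ih h1 (div_pos (hN _) (hN _)).le (mul_pos (hN _) (hN _)).le
    rwa [mul_assoc, mul_div_cancel₀ _ (hN _).ne', mul_assoc (N i),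
      mul_div_cancel₀ _ (hN _).ne'] at h2

/-- The log-convex sequence each of whose ratios is a ratio of `N`, each occurring twice. -/
def doubledRatios (N : ℕ → ℝ) (n : ℕ) : ℝ := N (n / 2) * N ((n + 1) / 2)

theorem doubledRatios_pos {N : ℕ → ℝ} (hN : ∀ k, 0 < N k) (n : ℕ) : 0 < doubledRatios N n :=
  mul_pos (hN _) (hN _)

theorem doubledRatios_ratio {N : ℕ → ℝ} (hN : ∀ k, 0 < N k) (n : ℕ) :
    doubledRatios N (n + 1) / doubledRatios N n = N (n / 2 + 1) / N (n / 2) := by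
  have h : (n + 1 + 1) / 2 = n / 2 + 1 := by lia
  rw [doubledRatios, doubledRatios, h, mul_comm (N (n / 2)), mul_div_mul_left _ _ (hN _).ne']

theorem doubledRatios_logConvex {N : ℕ → ℝ} (hN : ∀ k, 0 < N k) (h : LogConvex N) :
    LogConvex (doubledRatios N) :=
  .of_ratio_monotone (doubledRatios_pos hN) fun i j hij => by
    dsimp only
    rw [doubledRatios_ratio hN, doubledRatios_ratio hN]
    exact h.ratio_monotone hN (Nat.div_le_div_right hij)

theorem doubledRatios_add_le {N : ℕ → ℝ} (hN : ∀ k, 0 < N k) (h : LogConvex N) (j k : ℕ) :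
    doubledRatios N (j + k) ≤ N j * N k := by
  wlog hjk : j ≤ k generalizing j k
  · rw [add_comm, mul_comm]
    exact this k j (by lia)
  have := h.mul_le_mul_of_add hN (i := j) (d := (j + k) / 2 - j) ((j + k + 1) / 2 - j)
  rwa [show j + ((j + k) / 2 - j) + ((j + k + 1) / 2 - j) = k by lia,
    show j + ((j + k) / 2 - j) = (j + k) / 2 by lia,
    show j + ((j + k + 1) / 2 - j) = (j + k + 1) / 2 by lia] at this

theorem summable_doubledRatios {N : ℕ → ℝ} (hN : ∀ k, 0 < N k)
    (hs : Summable fun k => N k / N (k + 1)) :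
    Summable fun n => doubledRatios N n / doubledRatios N (n + 1) := by
  have h (n : ℕ) : doubledRatios N n / doubledRatios N (n + 1) = N (n / 2) / N (n / 2 + 1) := by
    rw [← inv_div, doubledRatios_ratio hN, inv_div]
  simp only [h]
  refine Summable.even_add_odd ?_ ?_
  · simpa using hs
  · simpa [show ∀ k, (2 * k + 1) / 2 = k by lia] using hs

theorem ModerateGrowth.exists_bound {Q : ℕ → ℝ} (hQ0 : ∀ k, 0 < Q k) (h : ModerateGrowth Q) :
    ∃ A : ℝ, 0 < A ∧ ∀ j k, 0 < j → 0 < k → Q (j + k) ≤ A ^ (j + k) * (Q j * Q k) := by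
  obtain ⟨B, hB⟩ := h
  refine ⟨max B 1, by positivity, fun j k hj hk => ?_⟩
  have h1 := hB ⟨j, k, hj, hk, rfl⟩
  have hpos : 0 < Q (j + k) / (Q j * Q k) := div_pos (hQ0 _) (mul_pos (hQ0 _) (hQ0 _))
  have h2 : Q (j + k) / (Q j * Q k) =
      ((Q (j + k) / (Q j * Q k)) ^ (1 / ((j : ℝ) + (k : ℝ)))) ^ (j + k) := by
    rw [← Real.rpow_mul_natCast hpos.le]
    push_cast
    rw [one_div_mul_cancel (by positivity), Real.rpow_one]
  rw [← div_le_iff₀ (mul_pos (hQ0 _) (hQ0 _)), h2]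
  exact pow_le_pow_left₀ (Real.rpow_nonneg hpos.le _) (h1.trans (le_max_left _ _)) _

theorem exists_mem_LwSet_add_le {Q : ℕ → ℝ} (hQ0 : ∀ k, 0 < Q k) (hQ : WeaklyLogConvex Q)
    (hmg : ModerateGrowth Q) {L : ℕ → ℝ} (hL : L ∈ LwSet Q) :
    ∃ L' ∈ LwSet Q, ∃ C : ℝ, 0 < C ∧ ∀ j k : ℕ, (j ≠ 0 ∨ k ≠ 0 ∨ Q 0 ≤ L 0 ^ 2) →
      L' (j + k) ≤ C ^ (j + k) * (L j * L k) := by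
  obtain ⟨hp, hQL, hn, hl⟩ := hL
  obtain ⟨A, hA, hAQ⟩ := hmg.exists_bound hQ0
  set N : ℕ → ℝ := fun k => k.factorial * L k with hN
  have hs : Summable fun k => N k / N (k + 1) := (not_quasianalytic_iff_summable hp hl).1 hn
  have h0 (k : ℕ) : 0 < N k := by have := hp k; positivity
  -- The three entries serve the part from `N`, the case `j, k ≥ 1`, and the case `j = 0 < k`.
  set C : ℝ := max 1 (max A (1 / L 0)) with hC
  have hC1 : 1 ≤ C := le_max_left _ _
  have hCA : A ≤ C := (le_max_left _ _).trans (le_max_right _ _)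
  have hCL : 1 / L 0 ≤ C := (le_max_right _ _).trans (le_max_right _ _)
  refine ⟨_, mem_LwSet_max hQ0 hQ (doubledRatios_pos h0) (doubledRatios_logConvex h0 hl)
    (summable_doubledRatios h0 hs), C, by positivity, fun j k hjk => ?_⟩
  have hLL : 0 < L j * L k := mul_pos (hp _) (hp _)
  rw [div_le_iff₀ (by positivity)]
  refine max_le ?_ ?_
  · have hfac : (j.factorial : ℝ) * k.factorial ≤ (j + k).factorial := by
      exact_mod_cast Nat.le_of_dvd (Nat.factorial_pos _)
        (Nat.factorial_mul_factorial_dvd_factorial_add j k)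
    calc doubledRatios N (j + k) ≤ N j * N k := doubledRatios_add_le h0 hl j k
      _ = 1 * (L j * L k) * (j.factorial * k.factorial) := by simp only [hN]; ring
      _ ≤ C ^ (j + k) * (L j * L k) * (j + k).factorial := by
        gcongr
        exact one_le_pow₀ hC1
  · rw [mul_comm]
    refine mul_le_mul_of_nonneg_right ?_ (by positivity)
    have hone {k : ℕ} (hk : k ≠ 0) : Q k ≤ C ^ k * (L 0 * L k) := by
      have h1 : 1 ≤ C ^ k * L 0 := by
        have h2 : C ≤ C ^ k := le_self_pow₀ hC1 hk
        rw [div_le_iff₀ (hp 0)] at hCL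
        exact hCL.trans (mul_le_mul_of_nonneg_right h2 (hp 0).le)
      calc Q k ≤ 1 * L k := by rw [one_mul]; exact hQL k
        _ ≤ C ^ k * L 0 * L k := mul_le_mul_of_nonneg_right h1 (hp k).le
        _ = _ := by ring
    rcases Nat.eq_zero_or_pos j with rfl | hj
    · rcases Nat.eq_zero_or_pos k with rfl | hk
      · simpa [sq] using hjk
      · simpa using hone hk.ne'
    · rcases Nat.eq_zero_or_pos k with rfl | hk
      · simpa [mul_comm (L j)] using hone hj.ne'
      · have := hQ0 j
        have := hQ0 k
        calc Q (j + k) ≤ A ^ (j + k) * (Q j * Q k) := hAQ j k hj hk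
          _ ≤ C ^ (j + k) * (L j * L k) := by
            gcongr
            · exact (hp j).le
            · exact hQL j
            · exact hQL k

/-! ### Roots of log-convex sequences and the sequence `check Q` -/

theorem LogConvex.div_le_ratio_pow {N : ℕ → ℝ} (hN : ∀ k, 0 < N k) (h : LogConvex N) (k : ℕ) :
    N (k + 1) / N 0 ≤ (N (k + 1) / N k) ^ (k + 1) := by
  rw [← prod_range_ratio hN]
  refine (Finset.prod_le_prod (fun i _ => (div_pos (hN _) (hN _)).le) fun i hi =>
    h.ratio_monotone hN (Nat.lt_succ_iff.1 (Finset.mem_range.1 hi))).trans_eq ?_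
  rw [Finset.prod_const, Finset.card_range]

theorem LogConvex.ratio_zero_pow_le {N : ℕ → ℝ} (hN : ∀ k, 0 < N k) (h : LogConvex N) (k : ℕ) :
    (N 1 / N 0) ^ k ≤ N k / N 0 := by
  calc (N 1 / N 0) ^ k = ∏ _i ∈ Finset.range k, N 1 / N 0 := by
        rw [Finset.prod_const, Finset.card_range]
    _ ≤ ∏ i ∈ Finset.range k, N (i + 1) / N i :=
      Finset.prod_le_prod (fun i _ => (div_pos (hN _) (hN _)).le)
        fun i _ => h.ratio_monotone hN (Nat.zero_le i)
    _ = N k / N 0 := prod_range_ratio hN k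

theorem LogConvex.root_le_root {N : ℕ → ℝ} (hN : ∀ k, 0 < N k) (h : LogConvex N) (h1 : N 0 = 1)
    {k : ℕ} {x y : ℝ} (hx : 0 < x) (hy : 0 < y) (hxk : x ^ k = N k)
    (hyk : y ^ (k + 1) = N (k + 1)) (hk : k ≠ 0) : x ≤ y := by
  have h2 := h.div_le_ratio_pow hN k
  rw [h1, div_one, ← hyk, ← hxk] at h2
  have h3 := le_of_pow_le_pow_left₀ k.succ_ne_zero (by positivity) h2
  rw [le_div_iff₀ (by positivity), pow_succ', mul_le_mul_iff_right₀ hy] at h3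
  exact le_of_pow_le_pow_left₀ hk hy.le h3

/-- The partial sums `1 + ∑_{1 ≤ j ≤ k} 1 / d j`. -/
noncomputable def reciprocalSum (d : ℕ → ℝ) (k : ℕ) : ℝ := 1 + ∑ j ∈ Finset.Ioc 0 k, 1 / d j

theorem reciprocalSum_succ (d : ℕ → ℝ) (k : ℕ) :
    reciprocalSum d (k + 1) = reciprocalSum d k + 1 / d (k + 1) := by
  rw [reciprocalSum, Finset.sum_Ioc_succ_top (Nat.zero_le k), reciprocalSum, add_assoc]

/-- The product in `check Q` is inverse to a sum: the recursion
`1 / σ_k = 1 / σ_(k-1) + 1 / (b_k σ_k)` holds for `σ_k = ∏_{j ≤ k} (1 - 1 / b_j)`, and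
`b_k σ_k` is the `k`-th root `d_k` of `k! * check Q k`. As `check Q k` sees only a power of `σ_k`,
the sign of `σ_k` has to be recovered from the monotonicity of `d`. -/
theorem check_eq {Q : ℕ → ℝ} (hQ : ∀ k, 0 < Q k) (hpos : ∀ k, 0 < check Q k)
    (hlc : LogConvex (check Q)) {d : ℕ → ℝ} (hd : ∀ k ≠ 0, 0 < d k)
    (hdk : ∀ k ≠ 0, d k ^ k = k.factorial * check Q k) {k : ℕ} (hk : k ≠ 0) :
    Q k = check Q k * reciprocalSum d k ^ k := by
  set b : ℕ → ℝ := fun j => ((j.factorial : ℝ) * Q j) ^ (1 / (j : ℝ)) with hb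
  set σ : ℕ → ℝ := fun k => ∏ j ∈ Finset.Icc 1 k, (1 - 1 / b j) with hσ
  have hb0 (j : ℕ) : 0 < b j := Real.rpow_pos_of_pos (by have := hQ j; positivity) _
  have hbk {j : ℕ} (hj : j ≠ 0) : b j ^ j = j.factorial * Q j := by
    simp only [hb, one_div]
    exact Real.rpow_inv_natCast_pow (by have := hQ j; positivity) hj
  have hch {j : ℕ} (hj : j ≠ 0) : check Q j = Q j * σ j ^ j := by
    rw [check, if_neg hj, Finset.prod_pow]
  have hσs (j : ℕ) : σ (j + 1) = σ j * (1 - 1 / b (j + 1)) :=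
    Finset.prod_Icc_succ_top (by lia) _
  have habs {j : ℕ} (hj : j ≠ 0) : d j = |b j * σ j| := by
    refine (pow_left_inj₀ (hd j hj).le (abs_nonneg _) hj).1 ?_
    rw [hdk j hj, hch hj, ← mul_assoc, ← hbk hj, ← mul_pow, pow_abs, abs_of_pos]
    rw [mul_pow, hbk hj, mul_assoc, ← hch hj]
    have := hpos j
    positivity
  have hP0 (k : ℕ) : 0 < (k.factorial : ℝ) * check Q k := by have := hpos k; positivity
  have hmono {j : ℕ} (hj : j ≠ 0) : d j ≤ d (j + 1) :=
    (logConvex_factorial.mul hlc fun k => by positivity).root_le_root hP0 (by simp [check])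
      (hd j hj) (hd _ j.succ_ne_zero) (hdk j hj) (hdk _ j.succ_ne_zero) hj
  have key (j : ℕ) : 0 < σ j ∧ 1 / σ j = reciprocalSum d j ∧ (j ≠ 0 → 1 < b j) := by
    induction j with
    | zero => simp [hσ, reciprocalSum]
    | succ j ih =>
      obtain ⟨ih1, ih2, ih3⟩ := ih
      have hbj := hb0 (j + 1)
      have hpr : b (j + 1) * σ (j + 1) = σ j * (b (j + 1) - 1) := by
        rw [hσs]
        field_simp
      have hgt : 1 < b (j + 1) := by
        rcases Nat.eq_zero_or_pos j with rfl | hj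
        · have h1 := hch one_ne_zero ▸ hpos 1
          rw [pow_one] at h1
          have h2 := pos_of_mul_pos_right h1 (hQ 1).le
          have h3 : 0 < b (0 + 1) * σ (0 + 1) := mul_pos hbj h2
          rw [hpr] at h3
          have := pos_of_mul_pos_right h3 ih1.le
          linarith
        · by_contra! hle
          have h1 := habs j.succ_ne_zero
          have h2 := habs hj.ne'
          have h3 := hmono hj.ne'
          rw [hpr, abs_of_nonpos (mul_nonpos_of_nonneg_of_nonpos ih1.le (by linarith))] at h1
          rw [abs_of_pos (mul_pos (hb0 j) ih1)] at h2
          nlinarith [ih3 hj.ne']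
      have hσpos : 0 < σ (j + 1) := by
        have : 0 < b (j + 1) * σ (j + 1) := by
          rw [hpr]
          exact mul_pos ih1 (by linarith)
        exact pos_of_mul_pos_right this hbj.le
      refine ⟨hσpos, ?_, fun _ => hgt⟩
      rw [reciprocalSum_succ, ← ih2, habs j.succ_ne_zero, abs_of_pos (mul_pos hbj hσpos)]
      field_simp
      linarith [hpr]
  obtain ⟨h1, h2, -⟩ := key k
  rw [hch hk, ← h2, mul_assoc, ← mul_pow, mul_one_div_cancel h1.ne', one_pow, mul_one]

/-- The roots `d k = (k! * c k) ^ (1 / k)` grow at least linearly. -/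
theorem linear_le_root {c d : ℕ → ℝ} (hc : ∀ k, 0 < c k) (hlc : LogConvex c) (hc0 : c 0 = 1)
    (hd : ∀ k ≠ 0, 0 < d k) (hdk : ∀ k ≠ 0, d k ^ k = k.factorial * c k) {k : ℕ} (hk : k ≠ 0) :
    c 1 / Real.exp 1 * k ≤ d k := by
  refine le_of_pow_le_pow_left₀ hk (hd k hk).le ?_
  rw [hdk k hk]
  have h1 := hlc.ratio_zero_pow_le hc k
  rw [hc0, div_one, div_one] at h1
  have h2 := Real.pow_div_factorial_le_exp (k : ℝ) (Nat.cast_nonneg k) k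
  rw [div_le_iff₀ (by positivity), ← mul_one (k : ℝ), Real.exp_nat_mul, mul_one] at h2
  have h3 : 0 < Real.exp 1 ^ k := by positivity
  calc (c 1 / Real.exp 1 * k) ^ k = c 1 ^ k * ((k : ℝ) ^ k / Real.exp 1 ^ k) := by
        rw [mul_pow, div_pow]
        ring
    _ ≤ c k * k.factorial := by
        refine mul_le_mul h1 ?_ (by positivity) (hc k).le
        rw [div_le_iff₀ h3]
        linarith
    _ = _ := mul_comm _ _

section ReciprocalSum

variable {d : ℕ → ℝ} {κ : ℝ} (hκ : 0 < κ) (hd : ∀ k ≠ 0, κ * k ≤ d k)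
include hκ hd

theorem reciprocalSum_monotone : Monotone (reciprocalSum d) :=
  monotone_nat_of_le_succ fun k => by
    rw [reciprocalSum_succ]
    have : 0 < d (k + 1) := lt_of_lt_of_le (by positivity) (hd (k + 1) k.succ_ne_zero)
    have : 0 < 1 / d (k + 1) := by positivity
    linarith

theorem one_le_reciprocalSum (k : ℕ) : 1 ≤ reciprocalSum d k := by
  have := reciprocalSum_monotone hκ hd (Nat.zero_le k)
  simpa [reciprocalSum] using this

theorem reciprocalSum_le {m k : ℕ} (hmk : m ≤ k) :
    m * reciprocalSum d k ≤ (1 + 1 / κ) * k * reciprocalSum d m := by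
  have hm1 := one_le_reciprocalSum hκ hd m
  rcases Nat.eq_zero_or_pos m with rfl | hm
  · rw [Nat.cast_zero, zero_mul]
    positivity
  have h1 : ∑ j ∈ Finset.Ioc m k, 1 / d j ≤ ∑ j ∈ Finset.Ioc m k, 1 / (κ * m) := by
    refine Finset.sum_le_sum fun j hj => ?_
    have hj' := Finset.mem_Ioc.1 hj
    refine one_div_le_one_div_of_le (by positivity) (le_trans ?_ (hd j (by lia)))
    have : (m : ℝ) ≤ j := by exact_mod_cast hj'.1.le
    gcongr
  have h2 : reciprocalSum d k = reciprocalSum d m + ∑ j ∈ Finset.Ioc m k, 1 / d j := by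
    rw [reciprocalSum, reciprocalSum, add_assoc,
      Finset.sum_Ioc_consecutive _ (Nat.zero_le m) hmk]
  rw [Finset.sum_const, Nat.card_Ioc, nsmul_eq_mul, Nat.cast_sub hmk] at h1
  have hmk' : (m : ℝ) ≤ k := by exact_mod_cast hmk
  have hm' : (0 : ℝ) < m := by exact_mod_cast hm
  have h3 : m * (((k : ℝ) - m) * (1 / (κ * m))) = (k - m) * (1 / κ) := by field_simp
  have hκ' : 0 < 1 / κ := by positivity
  calc m * reciprocalSum d k
      ≤ m * reciprocalSum d m + (k - m) * (1 / κ) := by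
        rw [h2, mul_add, ← h3]
        gcongr
    _ ≤ k * reciprocalSum d m + k * (1 / κ) * reciprocalSum d m := by
        have h4 : ((k : ℝ) - m) * (1 / κ) ≤ k * (1 / κ) := by gcongr; linarith
        have h5 : k * (1 / κ) ≤ k * (1 / κ) * reciprocalSum d m :=
          le_mul_of_one_le_right (by positivity) hm1
        have h6 : m * reciprocalSum d m ≤ k * reciprocalSum d m := by gcongr
        linarith
    _ = _ := by ring

/-- `reciprocalSum d` grows subexponentially. -/
theorem eventually_reciprocalSum_pow_le (a : ℝ) (m : ℕ) :
    ∀ᶠ k : ℕ in Filter.atTop, (reciprocalSum d k * Real.exp a) ^ m ≤ Real.exp 1 ^ k := by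
  set B : ℝ := (1 + 1 / κ) * reciprocalSum d 1 * Real.exp a with hB
  have h1 : Filter.Tendsto (fun k : ℕ => B ^ m * ((k : ℝ) ^ m * Real.exp (-k))) Filter.atTop
      (nhds 0) := by
    simpa using ((Real.tendsto_pow_mul_exp_neg_atTop_nhds_zero m).comp
      (tendsto_natCast_atTop_atTop (R := ℝ))).const_mul (B ^ m)
  filter_upwards [h1.eventually (gt_mem_nhds one_pos), Filter.eventually_ge_atTop 1] with k hk hk1
  have h2 := reciprocalSum_le hκ hd hk1
  rw [Nat.cast_one, one_mul] at h2
  have h3 : reciprocalSum d k * Real.exp a ≤ B * k := by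
    calc reciprocalSum d k * Real.exp a
        ≤ (1 + 1 / κ) * k * reciprocalSum d 1 * Real.exp a := by gcongr
      _ = B * k := by rw [hB]; ring
  have h0 : 0 ≤ reciprocalSum d k * Real.exp a :=
    mul_nonneg (zero_le_one.trans (one_le_reciprocalSum hκ hd k)) (Real.exp_pos _).le
  refine (pow_le_pow_left₀ h0 h3 m).trans ?_
  rw [← Real.exp_nat_mul, mul_one, mul_pow]
  rw [Real.exp_neg, ← mul_assoc, mul_inv_lt_iff₀ (Real.exp_pos _), one_mul] at hk
  exact hk.le

end ReciprocalSum

/-! ### Sparse sequences and step products -/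

theorem exists_index_function {q : ℕ → ℕ} (hq : StrictMono q) (h0 : q 0 = 0) :
    ∃ J : ℕ → ℕ, ∀ i j, q j ≤ i ↔ j ≤ J i := by
  refine ⟨fun i => Nat.findGreatest (fun j => q j ≤ i) i, fun i j => ⟨fun h => ?_, fun h => ?_⟩⟩
  · exact Nat.le_findGreatest ((hq.le_apply).trans h) h
  · exact (hq.monotone h).trans
      (Nat.findGreatest_spec (P := fun j => q j ≤ i) (Nat.zero_le i) (by simp [h0]))

theorem exists_ge_of_notMem_FSpace {Q f : ℕ → ℝ} (hQ : ∀ k, 0 < Q k) (hf : f ∉ FSpace Q)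
    {C ρ : ℝ} (hC : 0 < C) (hρ : 0 < ρ) (m : ℕ) :
    ∃ k ≥ m, C * ρ ^ k * k.factorial * Q k < |f k| := by
  by_contra! hcon
  have hpos (k : ℕ) : 0 < ρ ^ k * k.factorial * Q k := by have := hQ k; positivity
  have hnn (k : ℕ) : 0 ≤ |f k| / (ρ ^ k * k.factorial * Q k) :=
    div_nonneg (abs_nonneg _) (hpos k).le
  refine hf ⟨ρ, hρ, C + ∑ k ∈ Finset.range m, |f k| / (ρ ^ k * k.factorial * Q k),
    add_pos_of_pos_of_nonneg hC (Finset.sum_nonneg fun k _ => hnn k), fun k => ?_⟩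
  rw [mul_assoc, mul_assoc, ← mul_assoc (ρ ^ k)]
  rcases lt_or_ge k m with h | h
  · rw [← div_le_iff₀ (hpos k)]
    have := Finset.single_le_sum (fun i _ => hnn i) (Finset.mem_range.2 h)
    linarith
  · refine (hcon k h).trans ?_
    rw [mul_assoc, mul_assoc, ← mul_assoc (ρ ^ k)]
    exact mul_le_mul_of_nonneg_right
      (le_add_of_nonneg_right (Finset.sum_nonneg fun k _ => hnn k)) (hpos k).le

theorem exists_seq_of_forall_exists_gt {R : ℕ → ℕ → ℕ → Prop}
    (h : ∀ j m, ∃ k > m, R j m k) :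
    ∃ q : ℕ → ℕ, StrictMono q ∧ q 0 = 0 ∧ ∀ j, R j (q j) (q (j + 1)) := by
  choose nxt hlt hR using h
  let q : ℕ → ℕ := fun n => Nat.rec 0 (fun j m => nxt j m) n
  exact ⟨q, strictMono_nat_of_lt_succ fun j => hlt j (q j), rfl, fun j => hR j (q j)⟩

/-- A form of the weighted inequality between the geometric and the arithmetic mean. -/
theorem pow_mul_pow_le_mean_pow {a b : ℝ} (ha : 0 ≤ a) (hb : 0 ≤ b) {m k : ℕ} (hmk : m ≤ k)
    (hk : k ≠ 0) : a ^ m * b ^ (k - m) ≤ (m / k * a + (1 - m / k) * b) ^ k := by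
  have hk' : (0 : ℝ) < k := by positivity
  have hle : (m : ℝ) / k ≤ 1 := by
    rw [div_le_one hk']
    exact_mod_cast hmk
  have h := Real.geom_mean_le_arith_mean2_weighted (w₁ := m / k) (w₂ := 1 - m / k)
    (by positivity) (by linarith) ha hb (by ring)
  refine Eq.trans_le ?_ (pow_le_pow_left₀ (by positivity) h k)
  rw [mul_pow, ← Real.rpow_mul_natCast ha, ← Real.rpow_mul_natCast hb, div_mul_cancel₀ _ hk'.ne',
    sub_mul, div_mul_cancel₀ _ hk'.ne', one_mul, ← Nat.cast_sub hmk, Real.rpow_natCast,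
    Real.rpow_natCast]

/-- The product over `i < k` of `lam (j + 1)`, where `j = J i` is the index of the block of `i`. -/
noncomputable def stepProduct (lam : ℕ → ℝ) (J : ℕ → ℕ) (k : ℕ) : ℝ :=
  ∏ i ∈ Finset.range k, lam (J i + 1)

section StepProduct

variable {lam : ℕ → ℝ} {q J : ℕ → ℕ} (hJ : ∀ i j, q j ≤ i ↔ j ≤ J i) (hlam : Monotone lam)
  (hlam1 : ∀ j, 1 ≤ lam j)

include hlam1 in
theorem stepProduct_pos (k : ℕ) : 0 < stepProduct lam J k :=
  Finset.prod_pos fun _ _ => zero_lt_one.trans_le (hlam1 _)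

include hJ hlam hlam1 in
theorem stepProduct_logConvex : LogConvex (stepProduct lam J) := by
  refine .of_ratio_monotone (stepProduct_pos hlam1) fun i j hij => ?_
  have h (k : ℕ) : stepProduct lam J (k + 1) / stepProduct lam J k = lam (J k + 1) := by
    rw [div_eq_iff (stepProduct_pos hlam1 k).ne', stepProduct, Finset.prod_range_succ, mul_comm]
    rfl
  simp only [h]
  have : J i ≤ J j := (hJ j (J i)).1 (((hJ i (J i)).2 le_rfl).trans hij)
  exact hlam (by lia)

include hJ in
theorem index_eq {i j : ℕ} (h1 : q j ≤ i) (h2 : i < q (j + 1)) : J i = j := by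
  have := (hJ i j).1 h1
  have h3 : ¬ j + 1 ≤ J i := fun h => absurd ((hJ i (j + 1)).2 h) (by lia)
  lia

include hJ in
theorem stepProduct_eq_mul_pow {j k : ℕ} (h1 : q j ≤ k) (h2 : k ≤ q (j + 1)) :
    stepProduct lam J k = stepProduct lam J (q j) * lam (j + 1) ^ (k - q j) := by
  rw [stepProduct, stepProduct, ← Finset.prod_range_mul_prod_Ico _ h1]
  congr 1
  rw [Finset.prod_congr rfl fun i hi => ?_, Finset.prod_const, Nat.card_Ico]
  have := Finset.mem_Ico.1 hi
  rw [index_eq hJ this.1 (by lia)]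

include hJ hlam hlam1 in
theorem stepProduct_le (j : ℕ) : stepProduct lam J (q (j + 1)) ≤ lam (j + 1) ^ q (j + 1) := by
  refine (Finset.prod_le_prod (fun i _ => (zero_lt_one.trans_le (hlam1 _)).le) fun i hi =>
    hlam (?_ : J i + 1 ≤ j + 1)).trans_eq (by simp)
  by_contra! h
  have h1 := (hJ i (j + 1)).2 (by lia)
  have := Finset.mem_range.1 hi
  lia

include hJ hlam1 in
/-- If the sequence `q` is sparse enough, then at the end of each block the product is dominated by
the contribution of that block. -/
theorem pow_le_stepProduct_mul (h0 : q 0 = 0) (hq : StrictMono q)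
    (hsp : ∀ j, lam (j + 1) ^ q j ≤ Real.exp 1 ^ q (j + 1)) (j : ℕ) :
    lam j ^ q j ≤ stepProduct lam J (q j) * Real.exp 1 ^ q j := by
  rcases j with _ | j
  · simp [h0, stepProduct]
  have hle := (hq j.lt_succ_self).le
  simp only [Nat.succ_eq_add_one] at hle
  rw [stepProduct_eq_mul_pow hJ hle le_rfl]
  have h1 : 1 ≤ stepProduct lam J (q j) :=
    Finset.one_le_prod fun _ _ => hlam1 _
  have hl : 0 < lam (j + 1) := zero_lt_one.trans_le (hlam1 _)
  calc lam (j + 1) ^ q (j + 1) = 1 * lam (j + 1) ^ (q (j + 1) - q j) * lam (j + 1) ^ q j := by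
        rw [one_mul, ← pow_add, Nat.sub_add_cancel hle]
    _ ≤ _ := by
        gcongr
        exact hsp j

include hJ hlam1 in
/-- On the block between `q j` and `q (j + 1)`, the reciprocal `k`-th root of the product is at most
`e` times a convex combination of `1 / lam j` and `1 / lam (j + 1)`. -/
theorem one_le_stepProduct_mul_pow (h0 : q 0 = 0) (hq : StrictMono q)
    (hsp : ∀ j, lam (j + 1) ^ q j ≤ Real.exp 1 ^ q (j + 1)) {j k : ℕ} (h1 : q j ≤ k)
    (h2 : k ≤ q (j + 1)) (hk : k ≠ 0) :
    1 ≤ stepProduct lam J k * (Real.exp 1 *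
      ((q j : ℝ) / k * (1 / lam j) + (1 - (q j : ℝ) / k) * (1 / lam (j + 1)))) ^ k := by
  have hl (j : ℕ) : 0 < lam j := zero_lt_one.trans_le (hlam1 _)
  have hlj := hl j
  have hlj' := hl (j + 1)
  have hW := stepProduct_pos (J := J) hlam1
  have h3 := pow_mul_pow_le_mean_pow (a := 1 / lam j) (b := 1 / lam (j + 1)) (by positivity)
    (by positivity) h1 hk
  have h4 := pow_le_stepProduct_mul hJ hlam1 h0 hq hsp j
  have h5 : Real.exp 1 ^ q j ≤ Real.exp 1 ^ k :=
    pow_le_pow_right₀ (Real.one_le_exp zero_le_one) h1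
  have h6 : lam j ^ q j * lam (j + 1) ^ (k - q j) ≤ stepProduct lam J k * Real.exp 1 ^ k := by
    rw [stepProduct_eq_mul_pow hJ h1 h2]
    have := hW (q j)
    calc lam j ^ q j * lam (j + 1) ^ (k - q j)
        ≤ stepProduct lam J (q j) * Real.exp 1 ^ k * lam (j + 1) ^ (k - q j) := by
          gcongr
          exact h4.trans (by gcongr)
      _ = _ := by ring
  have := hW k
  calc 1 = lam j ^ q j * lam (j + 1) ^ (k - q j) *
        ((1 / lam j) ^ q j * (1 / lam (j + 1)) ^ (k - q j)) := by
        rw [one_div_pow, one_div_pow]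
        field_simp
    _ ≤ stepProduct lam J k * Real.exp 1 ^ k *
        ((q j : ℝ) / k * (1 / lam j) + (1 - (q j : ℝ) / k) * (1 / lam (j + 1))) ^ k := by
        gcongr
    _ = _ := by rw [mul_pow, mul_assoc]

end StepProduct

/-! ### Separating a sequence from `FSpace Q` -/

theorem sum_Ioc_div_sq_le (m n : ℕ) : ∑ k ∈ Finset.Ioc m n, (m : ℝ) / (k : ℝ) ^ 2 ≤ 1 := by
  rcases Nat.eq_zero_or_pos m with rfl | hm
  · simp
  rcases lt_or_ge n m with h | h
  · simp [Finset.Ioc_eq_empty_of_le h.le]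
  have h1 := sum_Ioc_inv_sq_le_sub (α := ℝ) hm.ne' h
  have hm' : (0 : ℝ) < m := by exact_mod_cast hm
  have h2 : (0 : ℝ) ≤ (n : ℝ)⁻¹ := by positivity
  simp only [div_eq_mul_inv]
  rw [← Finset.mul_sum]
  calc (m : ℝ) * ∑ k ∈ Finset.Ioc m n, ((k : ℝ) ^ 2)⁻¹ ≤ m * (m : ℝ)⁻¹ := by
        gcongr
        linarith
    _ = 1 := mul_inv_cancel₀ hm'.ne'

theorem sum_Ioc_eq_sum_range (F : ℕ → ℝ) (n : ℕ) :
    ∑ k ∈ Finset.Ioc 0 n, F k = ∑ k ∈ Finset.range n, F (k + 1) := by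
  induction n with
  | zero => simp
  | succ n ih => rw [Finset.sum_Ioc_succ_top (Nat.zero_le n), ih, Finset.sum_range_succ]

/-- A nonnegative series converges if its block sums are dominated by a summable sequence. -/
theorem summable_of_sum_block_le {F B : ℕ → ℝ} {q : ℕ → ℕ} (hq : StrictMono q) (h0 : q 0 = 0)
    (hF : ∀ k, 0 ≤ F k) (hB : Summable B) (hB0 : ∀ j, 0 ≤ B j)
    (h : ∀ j, ∑ k ∈ Finset.Ioc (q j) (q (j + 1)), F k ≤ B j) : Summable fun k => F (k + 1) := by
  refine summable_of_sum_range_le (c := ∑' j, B j) (fun k => hF _) fun n => ?_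
  have h1 (j : ℕ) : ∑ k ∈ Finset.Ioc 0 (q j), F k ≤ ∑ i ∈ Finset.range j, B i := by
    induction j with
    | zero => simp [h0]
    | succ j ih =>
      rw [← Finset.sum_Ioc_consecutive _ (Nat.zero_le _) (hq j.lt_succ_self).le,
        Finset.sum_range_succ]
      exact add_le_add ih (h j)
  rw [← sum_Ioc_eq_sum_range]
  refine (Finset.sum_le_sum_of_subset_of_nonneg
    (Finset.Ioc_subset_Ioc_right (hq.le_apply (x := n))) fun k _ _ => hF k).trans ?_
  exact (h1 n).trans (hB.sum_le_tsum _ fun j _ => hB0 j)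

/-- A log-convex sequence bounded below by `N 0 * x k ^ k` has summable reciprocal ratios if
`∑ 1 / x k` converges: by log-convexity `x (k + 1) ≤ N (k + 1) / N k`. -/
theorem LogConvex.summable_ratio {N x : ℕ → ℝ} (hN : ∀ k, 0 < N k) (h : LogConvex N)
    (hx : ∀ k, 0 < x (k + 1)) (hxN : ∀ k, N 0 * x (k + 1) ^ (k + 1) ≤ N (k + 1))
    (hs : Summable fun k => 1 / x (k + 1)) : Summable fun k => N k / N (k + 1) := by
  refine hs.of_nonneg_of_le (fun k => (div_pos (hN _) (hN _)).le) fun k => ?_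
  have h1 : x (k + 1) ^ (k + 1) ≤ (N (k + 1) / N k) ^ (k + 1) := by
    refine le_trans ?_ (h.div_le_ratio_pow hN k)
    rw [le_div_iff₀ (hN 0), mul_comm]
    exact hxN k
  have h2 := le_of_pow_le_pow_left₀ k.succ_ne_zero (div_pos (hN _) (hN _)).le h1
  rw [← inv_div, ← one_div]
  exact one_div_le_one_div_of_le (hx k) h2

/-- The convex combination of `1 / lam j` and `1 / lam (j + 1)`, times `e`, that controls the block
between `q j` and `q (j + 1)`, where `lam j = S (q j) * e ^ j`. -/
noncomputable def blockMean (S : ℕ → ℝ) (q : ℕ → ℕ) (j k : ℕ) : ℝ :=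
  Real.exp 1 * ((q j : ℝ) / k * (1 / (S (q j) * Real.exp j)) +
    (1 - (q j : ℝ) / k) * (1 / (S (q (j + 1)) * Real.exp ((j + 1 : ℕ) : ℝ))))

section BlockMean

variable {d : ℕ → ℝ} {κ : ℝ} (hκ : 0 < κ) (hd : ∀ k ≠ 0, κ * k ≤ d k) {q : ℕ → ℕ} {j k : ℕ}
include hκ hd

theorem blockMean_pos (hk : k ≠ 0) (h1 : q j ≤ k) : 0 < blockMean (reciprocalSum d) q j k := by
  have hS (k : ℕ) : 0 < reciprocalSum d k := zero_lt_one.trans_le (one_le_reciprocalSum hκ hd k)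
  have hk' : (0 : ℝ) < k := by positivity
  have hle : (q j : ℝ) / k ≤ 1 := by
    rw [div_le_one hk']
    exact_mod_cast h1
  have h3 := hS (q j)
  have h4 := hS (q (j + 1))
  refine mul_pos (Real.exp_pos _) ?_
  rcases hle.lt_or_eq with h | h
  · refine add_pos_of_nonneg_of_pos (by positivity) (mul_pos (by linarith) (by positivity))
  · rw [h]
    simp only [sub_self, zero_mul, add_zero, one_mul]
    positivity

theorem reciprocalSum_mul_blockMean_le (hk : k ≠ 0) (h1 : q j ≤ k) (h2 : k ≤ q (j + 1)) :
    reciprocalSum d k * blockMean (reciprocalSum d) q j k ≤ Real.exp 1 * (2 + 1 / κ) := by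
  have hS (k : ℕ) : 0 < reciprocalSum d k := zero_lt_one.trans_le (one_le_reciprocalSum hκ hd k)
  have hk' : (0 : ℝ) < k := by positivity
  have hle : (q j : ℝ) / k ≤ 1 := by
    rw [div_le_one hk']
    exact_mod_cast h1
  have hSj := hS (q j)
  have hSj' := hS (q (j + 1))
  have hSk := hS k
  have h3 := reciprocalSum_le hκ hd h1
  have h4 := reciprocalSum_monotone hκ hd h2
  have hfirst : reciprocalSum d k * ((q j : ℝ) / k * (1 / (reciprocalSum d (q j) * Real.exp j))) ≤
      1 + 1 / κ := by
    have : reciprocalSum d k * ((q j : ℝ) / k * (1 / (reciprocalSum d (q j) * Real.exp j))) =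
        (q j * reciprocalSum d k) / (k * reciprocalSum d (q j) * Real.exp j) := by
      field_simp
    rw [this, div_le_iff₀ (by positivity)]
    refine h3.trans ?_
    rw [← mul_assoc, ← mul_assoc]
    exact le_mul_of_one_le_right (by positivity) (Real.one_le_exp (Nat.cast_nonneg j))
  have hsecond : reciprocalSum d k * ((1 - (q j : ℝ) / k) *
      (1 / (reciprocalSum d (q (j + 1)) * Real.exp ((j + 1 : ℕ) : ℝ)))) ≤ 1 := by
    have h5 : 1 - (q j : ℝ) / k ≤ 1 := sub_le_self _ (by positivity)
    calc _ ≤ reciprocalSum d (q (j + 1)) *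
          (1 * (1 / (reciprocalSum d (q (j + 1)) * 1))) := by
          gcongr
          exact Real.one_le_exp (Nat.cast_nonneg _)
      _ = 1 := by field_simp
  calc _ = Real.exp 1 * (reciprocalSum d k *
        ((q j : ℝ) / k * (1 / (reciprocalSum d (q j) * Real.exp j))) +
        reciprocalSum d k * ((1 - (q j : ℝ) / k) *
        (1 / (reciprocalSum d (q (j + 1)) * Real.exp ((j + 1 : ℕ) : ℝ))))) := by
        rw [blockMean]
        ring
    _ ≤ _ := mul_le_mul_of_nonneg_left (by linarith) (Real.exp_pos _).le

theorem sum_blockMean_div_le (hqj : q j ≤ q (j + 1)) :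
    ∑ k ∈ Finset.Ioc (q j) (q (j + 1)), blockMean (reciprocalSum d) q j k / d k ≤
      Real.exp 1 * (1 / κ + 1) * Real.exp (-j) := by
  have hS (k : ℕ) : 0 < reciprocalSum d k := zero_lt_one.trans_le (one_le_reciprocalSum hκ hd k)
  have hSj' := hS (q (j + 1))
  have hterm : ∀ k ∈ Finset.Ioc (q j) (q (j + 1)), blockMean (reciprocalSum d) q j k / d k ≤
      Real.exp 1 * Real.exp (-j) * (1 / κ * (q j / (k : ℝ) ^ 2) +
        1 / reciprocalSum d (q (j + 1)) * (1 / d k)) := by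
    intro k hk
    have hk' := Finset.mem_Ioc.1 hk
    have hk0 : (0 : ℝ) < k := by exact_mod_cast (by lia : 0 < k)
    have hdk := hd k (by lia)
    have hd0 : 0 < d k := lt_of_lt_of_le (by positivity) hdk
    have hexp : Real.exp (-j) = 1 / Real.exp j := by rw [Real.exp_neg, one_div]
    have h1 : (q j : ℝ) / k * (1 / (reciprocalSum d (q j) * Real.exp j)) / d k ≤
        Real.exp (-j) * (1 / κ * (q j / (k : ℝ) ^ 2)) := by
      calc _ ≤ (q j : ℝ) / k * (1 / (1 * Real.exp j)) / (κ * k) := by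
            gcongr
            exact one_le_reciprocalSum hκ hd _
        _ = _ := by
            rw [hexp]
            field_simp
    have h2 : (1 - (q j : ℝ) / k) *
        (1 / (reciprocalSum d (q (j + 1)) * Real.exp ((j + 1 : ℕ) : ℝ))) / d k ≤
        Real.exp (-j) * (1 / reciprocalSum d (q (j + 1)) * (1 / d k)) := by
      have h5 : 1 - (q j : ℝ) / k ≤ 1 := sub_le_self _ (by positivity)
      calc _ ≤ 1 * (1 / (reciprocalSum d (q (j + 1)) * Real.exp (j : ℝ))) / d k := by
            gcongr
            exact Nat.le_succ j
        _ = _ := by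
            rw [hexp]
            field_simp
    calc _ = Real.exp 1 * ((q j : ℝ) / k * (1 / (reciprocalSum d (q j) * Real.exp j)) / d k +
          (1 - (q j : ℝ) / k) *
          (1 / (reciprocalSum d (q (j + 1)) * Real.exp ((j + 1 : ℕ) : ℝ))) / d k) := by
          rw [blockMean]
          ring
      _ ≤ Real.exp 1 * (Real.exp (-j) * (1 / κ * (q j / (k : ℝ) ^ 2)) +
          Real.exp (-j) * (1 / reciprocalSum d (q (j + 1)) * (1 / d k))) := by
          gcongr
      _ = _ := by ring
  refine (Finset.sum_le_sum hterm).trans ?_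
  rw [← Finset.mul_sum, Finset.sum_add_distrib, ← Finset.mul_sum, ← Finset.mul_sum]
  have h3 := sum_Ioc_div_sq_le (q j) (q (j + 1))
  have h4 : ∑ k ∈ Finset.Ioc (q j) (q (j + 1)), 1 / d k ≤ reciprocalSum d (q (j + 1)) := by
    have h5 := Finset.sum_Ioc_consecutive (fun k => 1 / d k) (Nat.zero_le (q j)) hqj
    have h6 := one_le_reciprocalSum hκ hd (q j)
    rw [reciprocalSum] at h6 ⊢
    linarith
  calc _ ≤ Real.exp 1 * Real.exp (-j) * (1 / κ * 1 + 1 / reciprocalSum d (q (j + 1)) *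
        reciprocalSum d (q (j + 1))) := by gcongr
    _ = _ := by
      rw [one_div_mul_cancel hSj'.ne']
      ring

end BlockMean

/-- The heart of the first assertion: if `Q k = c k * S k ^ k` with `c` log-convex and `S` the
reciprocal sum of the roots of `k! * c k`, every sequence outside `FSpace Q` is outside `FSpace L`
for some `L` in `LSet Q`. -/
theorem exists_mem_LSet_notMem {Q c d f : ℕ → ℝ} {κ : ℝ} (hQ : ∀ k, 0 < Q k) (hc : ∀ k, 0 < c k)
    (hlc : LogConvex c) (hc0 : c 0 = 1) (hκ : 0 < κ) (hd : ∀ k ≠ 0, κ * k ≤ d k)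
    (hdk : ∀ k ≠ 0, d k ^ k = k.factorial * c k)
    (hQc : ∀ k ≠ 0, Q k = c k * reciprocalSum d k ^ k) (hf : f ∉ FSpace Q) :
    ∃ L ∈ LSet Q, f ∉ FSpace L := by
  set S := reciprocalSum d with hSdef
  have hS1 (k : ℕ) : 1 ≤ S k := one_le_reciprocalSum hκ hd k
  have hSm : Monotone S := reciprocalSum_monotone hκ hd
  have hd0 {k : ℕ} (hk : k ≠ 0) : 0 < d k := lt_of_lt_of_le (by positivity) (hd k hk)
  -- `q (j + 1)` is so large that the previous blocks are negligible, and `|f|` is there larger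
  -- than the future `L` by factors exceeding every geometric sequence.
  obtain ⟨q, hq, hq0, hR⟩ := exists_seq_of_forall_exists_gt
    (R := fun j m k => (S k * Real.exp ((j + 1 : ℕ) : ℝ)) ^ m ≤ Real.exp 1 ^ k ∧
      ((j + 1 : ℕ) : ℝ) * (Real.exp ((j + 1 : ℕ) : ℝ) ^ 2) ^ k * k.factorial * Q k < |f k|)
    fun j m => by
      obtain ⟨K, hK⟩ := Filter.eventually_atTop.1
        (eventually_reciprocalSum_pow_le hκ hd ((j + 1 : ℕ) : ℝ) m)
      obtain ⟨k, hk, hfk⟩ := exists_ge_of_notMem_FSpace hQ hf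
        (C := ((j + 1 : ℕ) : ℝ)) (ρ := Real.exp ((j + 1 : ℕ) : ℝ) ^ 2) (by positivity)
        (by positivity) (max K (m + 1))
      exact ⟨k, (le_max_right _ _).trans hk, hK k ((le_max_left _ _).trans hk), hfk⟩
  obtain ⟨J, hJ⟩ := exists_index_function hq hq0
  set lam : ℕ → ℝ := fun j => S (q j) * Real.exp j with hlamdef
  have hlam : Monotone lam := fun i j hij => by
    have := hSm (hq.monotone hij)
    have := zero_le_one.trans (hS1 (q j))
    simp only [hlamdef]
    gcongr
  have hlam1 (j : ℕ) : 1 ≤ lam j :=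
    one_le_mul_of_one_le_of_one_le (hS1 _) (Real.one_le_exp (Nat.cast_nonneg j))
  set W := stepProduct lam J with hW
  have hW0 (k : ℕ) : 0 < W k := stepProduct_pos hlam1 k
  -- The block containing `k ≥ 1`, closed on the right.
  have hblock {k : ℕ} (hk : k ≠ 0) : q (J (k - 1)) ≤ k ∧ k ≤ q (J (k - 1) + 1) := by
    have h1 := (hJ (k - 1) (J (k - 1))).2 le_rfl
    have h2 : ¬ q (J (k - 1) + 1) ≤ k - 1 := fun h => by
      have := (hJ _ _).1 h
      lia
    lia
  set X : ℕ → ℝ := fun k => blockMean S q (J (k - 1)) k with hX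
  have hX0 {k : ℕ} (hk : k ≠ 0) : 0 < X k := blockMean_pos hκ hd hk (hblock hk).1
  have hWX {k : ℕ} (hk : k ≠ 0) : 1 ≤ W k * X k ^ k :=
    one_le_stepProduct_mul_pow hJ hlam1 hq0 hq (fun j => (hR j).1) (hblock hk).1 (hblock hk).2 hk
  set A : ℝ := Real.exp 1 * (2 + 1 / κ) with hA
  have hA0 : 0 < A := by positivity
  have hXA {k : ℕ} (hk : k ≠ 0) : S k * X k ≤ A :=
    reciprocalSum_mul_blockMean_le hκ hd hk (hblock hk).1 (hblock hk).2
  clear_value A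
  have hXs : Summable fun k => X (k + 1) / d (k + 1) := by
    refine (summable_of_sum_block_le (F := fun k => if k = 0 then 0 else X k / d k)
      (B := fun j => Real.exp 1 * (1 / κ + 1) * Real.exp (-j)) hq hq0 (fun k => ?_)
      (Real.summable_exp_neg_nat.mul_left _) (fun j => by positivity) fun j => ?_).congr
        fun k => by simp
    · split_ifs with hk
      · exact le_rfl
      · exact (div_pos (hX0 hk) (hd0 hk)).le
    · refine (Finset.sum_congr rfl fun k hk => ?_).trans_le
        (sum_blockMean_div_le hκ hd (hq j.lt_succ_self).le)
      have hk' := Finset.mem_Ioc.1 hk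
      rw [if_neg (by lia)]
      simp only [hX]
      rw [index_eq hJ (j := j) (by lia) (by lia)]
  set C₁ : ℝ := max 1 (Q 0) with hC₁
  have hC0 : 0 < C₁ := by positivity
  set L : ℕ → ℝ := fun k => C₁ * A ^ k * (c k * W k) with hL
  have hL0 (k : ℕ) : 0 < L k := by
    have := hc k
    have := hW0 k
    positivity
  have hLlc : LogConvex L := (logConvex_geometric C₁ A).mul
    (hlc.mul (stepProduct_logConvex hJ hlam hlam1) hc) fun k => by positivity
  have hW00 : W 0 = 1 := by simp [hW, stepProduct]
  refine ⟨L, ⟨hL0, fun k => ?_, ?_, hLlc⟩, ?_⟩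
  · rcases Nat.eq_zero_or_pos k with rfl | hk
    · simp [hL, hc0, hW00, hC₁]
    · rw [hQc k hk.ne']
      have h1 : S k ^ k ≤ A ^ k * W k := by
        have h0 : 0 ≤ S k := zero_le_one.trans (hS1 k)
        have hXk := hX0 hk.ne'
        have hWk := hW0 k
        calc S k ^ k ≤ S k ^ k * (W k * X k ^ k) :=
              le_mul_of_one_le_right (by positivity) (hWX hk.ne')
          _ = (S k * X k) ^ k * W k := by ring
          _ ≤ _ := by
            gcongr
            exact hXA hk.ne'
      have h2 := hc k
      have h3 := hW0 k
      calc c k * S k ^ k ≤ c k * (A ^ k * W k) := by gcongr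
        _ = 1 * A ^ k * (c k * W k) := by ring
        _ ≤ L k := by
          simp only [hL]
          gcongr
          exact le_max_left _ _
  · refine not_quasianalytic_of_summable hL0 ?_
    refine (logConvex_factorial.mul hLlc fun k => by positivity).summable_ratio
      (x := fun k => A * (d k / X k)) (fun k => by have := hL0 k; positivity)
      (fun k => mul_pos hA0 (div_pos (hd0 k.succ_ne_zero) (hX0 k.succ_ne_zero))) (fun k => ?_) ?_
    · have h1 := hWX k.succ_ne_zero
      have hXk := hX0 k.succ_ne_zero
      have hck := hc (k + 1)
      simp only [Nat.succ_eq_add_one] at h1 hXk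
      simp only [hL, hc0, hW00, Nat.factorial_zero, Nat.cast_one, pow_zero, mul_one, one_mul]
      rw [mul_pow, div_pow, hdk _ k.succ_ne_zero]
      calc C₁ * (A ^ (k + 1) * ((k + 1).factorial * c (k + 1) / X (k + 1) ^ (k + 1)))
          = C₁ * (A ^ (k + 1) * ((k + 1).factorial * c (k + 1))) *
            (1 / X (k + 1) ^ (k + 1)) := by ring
        _ ≤ C₁ * (A ^ (k + 1) * ((k + 1).factorial * c (k + 1))) * W (k + 1) := by
          gcongr
          rwa [div_le_iff₀ (by positivity)]
        _ = _ := by ring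
    · refine (hXs.mul_left (1 / A)).congr fun k => ?_
      rw [one_div_mul_eq_div, ← one_div_div (d (k + 1)), div_div, mul_comm A]
  · rintro ⟨ρ, hρ, C, hC, hfL⟩
    -- Compare the two bounds at `k = q (j + 1)` for large `j`.
    obtain ⟨j, hj1, hj2⟩ : ∃ j : ℕ, C * C₁ ≤ ((j + 1 : ℕ) : ℝ) ∧
        ρ * A ≤ Real.exp ((j + 1 : ℕ) : ℝ) := by
      obtain ⟨j, hj⟩ := exists_nat_ge (max (C * C₁) (ρ * A))
      have h1 : (j : ℝ) ≤ ((j + 1 : ℕ) : ℝ) := by exact_mod_cast j.le_succ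
      refine ⟨j, (le_max_left _ _).trans (hj.trans h1), ?_⟩
      have := Real.add_one_le_exp ((j + 1 : ℕ) : ℝ)
      linarith [(le_max_right _ _).trans hj]
    have h1 := (hR j).2.trans_le (hfL (q (j + 1)))
    have hk : q (j + 1) ≠ 0 := (Nat.zero_lt_of_lt (hq j.lt_succ_self)).ne'
    have h2 : W (q (j + 1)) ≤ lam (j + 1) ^ q (j + 1) := stepProduct_le hJ hlam hlam1 j
    revert h1 h2 hk
    generalize hkdef : q (j + 1) = k
    intro h1 hk h2
    set E : ℝ := Real.exp ((j + 1 : ℕ) : ℝ) with hE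
    have hE0 : 0 < E := Real.exp_pos _
    have hck := hc k
    have hSk := zero_lt_one.trans_le (hS1 k)
    refine absurd h1 (not_lt.2 ?_)
    calc C * ρ ^ k * k.factorial * L k
        ≤ C * ρ ^ k * k.factorial * (C₁ * A ^ k * (c k * (S k * E) ^ k)) := by
          simp only [hL]
          gcongr
          simpa only [hlamdef, hkdef] using h2
      _ = C * C₁ * ((ρ * A) ^ k * E ^ k) * k.factorial * (c k * S k ^ k) := by
          rw [mul_pow, mul_pow]
          ring
      _ ≤ ((j + 1 : ℕ) : ℝ) * (E ^ k * E ^ k) * k.factorial * (c k * S k ^ k) := by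
          gcongr
      _ = _ := by
          rw [← mul_pow, ← sq, hQc k hk]

theorem FSpace_mono {Q L : ℕ → ℝ} (h : ∀ k, Q k ≤ L k) : FSpace Q ⊆ FSpace L := by
  rintro f ⟨ρ, hρ, C, hC, hf⟩
  refine ⟨ρ, hρ, C, hC, fun k => (hf k).trans ?_⟩
  have := h k
  gcongr

theorem FSpace_eq_iInter {Q : ℕ → ℝ} (hQ : ∀ k, 0 < Q k) (hpos : ∀ k, 0 < check Q k)
    (hlc : LogConvex (check Q)) : FSpace Q = ⋂ L ∈ LSet Q, FSpace L := by
  refine Set.Subset.antisymm (Set.subset_iInter₂ fun L hL => FSpace_mono hL.2.1) fun f hf => ?_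
  by_contra hfQ
  have hP (k : ℕ) : 0 < (k.factorial : ℝ) * check Q k := by have := hpos k; positivity
  set d : ℕ → ℝ := fun k => ((k.factorial : ℝ) * check Q k) ^ ((k : ℝ)⁻¹) with hdd
  have hd (k : ℕ) (_ : k ≠ 0) : 0 < d k := Real.rpow_pos_of_pos (hP k) _
  have hdk (k : ℕ) (hk : k ≠ 0) : d k ^ k = k.factorial * check Q k :=
    Real.rpow_inv_natCast_pow (hP k).le hk
  have hc0 : check Q 0 = 1 := if_pos rfl
  obtain ⟨L, hL, hfL⟩ := exists_mem_LSet_notMem hQ hpos hlc hc0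
    (div_pos (hpos 1) (Real.exp_pos 1)) (fun k hk => linear_le_root hpos hlc hc0 hd hdk hk) hdk
    (fun k hk => check_eq hQ hpos hlc hd hdk hk) hfQ
  exact hfL (Set.mem_iInter₂.1 hf L hL)

end DenjoyCarleman

theorem theorem1p6 (Q : ℕ → ℝ) (hpos : ∀ k, 0 < Q k)
    (hQ : DenjoyCarleman.Quasianalytic Q) :
    ((∀ k, 0 < DenjoyCarleman.check Q k) →
      DenjoyCarleman.LogConvex (DenjoyCarleman.check Q) →
      DenjoyCarleman.FSpace Q = ⋂ L ∈ DenjoyCarleman.LSet Q, DenjoyCarleman.FSpace L) ∧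
    (DenjoyCarleman.WeaklyLogConvex Q →
      ∀ L₁ ∈ DenjoyCarleman.LwSet Q, ∀ L₂ ∈ DenjoyCarleman.LwSet Q,
        ∃ L ∈ DenjoyCarleman.LwSet Q, (∀ k, L k ≤ L₁ k) ∧ (∀ k, L k ≤ L₂ k)) ∧
    (DenjoyCarleman.WeaklyLogConvex Q → DenjoyCarleman.ModerateGrowth Q →
      ∀ L ∈ DenjoyCarleman.LwSet Q,
        ∃ L' ∈ DenjoyCarleman.LwSet Q, ∃ C : ℝ, 0 < C ∧
          ∀ j k : ℕ, (j ≠ 0 ∨ k ≠ 0 ∨ Q 0 ≤ L 0 ^ 2) →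
            L' (j + k) ≤ C ^ (j + k) * (L j * L k)) :=
  ⟨fun h0 h1 => DenjoyCarleman.FSpace_eq_iInter hpos h0 h1,
    fun h _ h₁ _ h₂ => DenjoyCarleman.exists_le_le_mem_LwSet hpos h h₁ h₂,
    fun h hmg _ hL => DenjoyCarleman.exists_mem_LwSet_add_le hpos h hmg hL⟩
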